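/- Let $R$ be a commutative Noetherian ring, $K$ a semidualizing $R$-module (that is, $K$ is finitely generated, the homothety map $R\to\operatorname{Hom}_R(K,K)$ is an isomorphism, and $\operatorname{Ext}^i_R(K,K)=0$ for all $i>0$), and $n\ge 0$ an integer. All modules are finitely generated. The grade of $M$ is $\operatorname{grade}M=\inf\{i\mid\operatorname{Ext}^i_R(M,R)\ne0\}$. A module $M$ is called $\mathcal G_K$-perfect if $\operatorname{grade}M=\mathcal G_K\text{-}\dim_R M$, the least length of a resolution of $M$ by totally $K$-reflexive modules (a module $G$ is totally $K$-reflexive if the evaluation map $G\to\operatorname{Hom}_R(\operatorname{Hom}_R(G,K),K)$ is bijective and $\operatorname{Ext}^i_R(G,K)=0=\operatorname{Ext}^i_R(\operatorname{Hom}_R(G,K),K)$ for all $i>0$). It is called perfect if $\operatorname{grade}M=\operatorname{pd}_RM$, and $\mathcal C$-perfect if $\operatorname{grade}M=\operatorname{CI-dim}_RM$, the complete intersection dimension of Avramov, Gasharov and Peeva. Let $\mathcal G^n_K(\mathcal P)$ and $\mathcal P^n(R)$ be the classes of $\mathcal G_K$-perfect and of perfect $R$-modules of grade $n$. For a class $\mathcal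 X$ of modules let $\operatorname{Epi}(\mathcal X)$ be the set of epimorphisms $\phi:X\twoheadrightarrow M$ with $X\in\mathcal X$ and $\operatorname{grade}M=\operatorname{grade}X$. For such a $\phi$, with inclusion $j:\ker\phi\to X$, let $\mathcal L^n_K(\phi):\operatorname{Ext}^n_R(X,K)\twoheadrightarrow\operatorname{im}\operatorname{Ext}^n_R(j,K)$ be the epimorphism induced by $\operatorname{Ext}^n_R(j,K)$. Write $\phi\equiv\psi$ for $\phi:X\twoheadrightarrow M$ and $\psi:Y\twoheadrightarrow N$ if there are isomorphisms $\alpha:M\to N$ and $\beta:X\to Y$ with $\alpha\phi=\psi\beta$. Modules $M$ and $N$ are directly linked with respect to $\mathcal X$ (and $K$, $n$) if there are $\phi,\psi\in\operatorname{Epi}(\mathcal X)$ with images $M$ and $N$ such that $\phi\equiv\mathcal L^n_K(\psi)$ and $\psi\equiv\mathcal L^n_K(\phi)$. They are in the same liaison class with respect to $\mathcal X$ if they are joined by a chain of $m$ direct linkages for some $m>0$. Then the following hold for $R$-modules $M$ and $N$. (i) If $M$ and $N$ are in the same liaison class with respect to $\mathcal G^n_K(\mathcal P)$, then $M$ is $\mathcal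 G_K$-perfect if and only if $N$ is $\mathcal G_K$-perfect. (ii) If $M$ and $N$ are in the same liaison class with respect to $\mathcal P^n(R)$ (in particular, for $K=R$), then $M$ is perfect if and only if $N$ is perfect, and $M$ is $\mathcal C$-perfect if and only if $N$ is $\mathcal C$-perfect. -/

import Mathlib

open CategoryTheory CategoryTheory.Abelian
open scoped TensorProduct

universe u

namespace Liaison

noncomputable section

/-! ### Semidualizing modules, grade and Gorenstein dimension -/

/-- A finitely generated `R`-module `K` is semidualizing if the homothety map
`R → Hom_R(K, K)` is an isomorphism and `Ext^i_R(K, K) = 0` for all `i > 0`. -/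
structure IsSemidualizing {R : Type u} [CommRing R] (K : ModuleCat.{u} R) : Prop where
  finite : Module.Finite R K
  homothety_bijective : Function.Bijective (LinearMap.lsmul R K)
  ext_self : ∀ i : ℕ, 0 < i → Subsingleton (Ext K K i)

/-- The grade `inf {i | Ext^i_R(M, R) ≠ 0}` of a module (`⊤` for the zero module). -/
def grade {R : Type u} [CommRing R] (M : ModuleCat.{u} R) : ℕ∞ :=
  ⨅ (i : ℕ) (_ : Nontrivial (Ext M (ModuleCat.of R R) i)), (i : ℕ∞)

/-- The natural evaluation map `M → Hom_R(Hom_R(M, K), K)`, `m ↦ (f ↦ f m)`. -/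
def evalMap {R : Type u} [CommRing R] (K M : ModuleCat.{u} R) :
    M →ₗ[R] (M →ₗ[R] K) →ₗ[R] K :=
  (LinearMap.id : (M →ₗ[R] K) →ₗ[R] (M →ₗ[R] K)).flip

/-- Totally `K`-reflexive modules. -/
structure IsTotallyReflexive {R : Type u} [CommRing R] (K M : ModuleCat.{u} R) : Prop where
  finite : Module.Finite R M
  eval_bijective : Function.Bijective (evalMap K M)
  ext_eq_zero : ∀ i : ℕ, 0 < i → Subsingleton (Ext M K i)
  ext_dual_eq_zero : ∀ i : ℕ, 0 < i → Subsingleton (Ext (ModuleCat.of R (M →ₗ[R] K)) K i)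

/-- `HasGKResolution K k M`: there is an exact sequence `0 → G_k → ⋯ → G_0 → M → 0` in which
all `G_i` are totally `K`-reflexive (the `G_i` may be zero), built from short exact sequences
`0 → M' → G → M → 0`. -/
inductive HasGKResolution {R : Type u} [CommRing R] (K : ModuleCat.{u} R) :
    ℕ → ModuleCat.{u} R → Prop
  | zero {M : ModuleCat.{u} R} (hM : IsTotallyReflexive K M) : HasGKResolution K 0 M
  | succ {k : ℕ} {S : ShortComplex (ModuleCat.{u} R)} (hS : S.ShortExact)
      (hG : IsTotallyReflexive K S.X₂) (h : HasGKResolution K k S.X₁) :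
      HasGKResolution K (k + 1) S.X₃

/-- The `G_K`-dimension: the minimal length of a resolution by totally `K`-reflexive modules,
and `⊤` if there is none. -/
def gkDim {R : Type u} [CommRing R] (K M : ModuleCat.{u} R) : ℕ∞ :=
  ⨅ (k : ℕ) (_ : HasGKResolution K k M), (k : ℕ∞)

/-! ### Complete intersection dimension -/

/-- A quasi-deformation `R → R' ← Q` of a local ring `R`: local homomorphisms of Noetherian local
rings, the first one flat, the second one surjective with kernel generated by a `Q`-regular
sequence. -/
structure QuasiDeformation (R : Type u) [CommRing R] [IsLocalRing R] where
  R' : Type u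
  [commRing : CommRing R']
  [isLocalRing : IsLocalRing R']
  [isNoetherianRing : IsNoetherianRing R']
  [algebra : Algebra R R']
  [flat : Module.Flat R R']
  [isLocalHom : IsLocalHom (algebraMap R R')]
  Q : Type u
  [commRingQ : CommRing Q]
  [isLocalRingQ : IsLocalRing Q]
  [isNoetherianRingQ : IsNoetherianRing Q]
  π : Q →+* R'
  surjective : Function.Surjective π
  seq : List Q
  isRegular : RingTheory.Sequence.IsRegular Q seq
  ker_eq : RingHom.ker π = Ideal.ofList seq

attribute [instance] QuasiDeformation.commRing QuasiDeformation.isLocalRing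
  QuasiDeformation.isNoetherianRing QuasiDeformation.algebra QuasiDeformation.flat
  QuasiDeformation.isLocalHom QuasiDeformation.commRingQ QuasiDeformation.isLocalRingQ
  QuasiDeformation.isNoetherianRingQ

/-- `pd_Q (R' ⊗_R M)`. -/
def QuasiDeformation.pdModule {R : Type u} [CommRing R] [IsLocalRing R]
    (D : QuasiDeformation R) (M : ModuleCat.{u} R) : WithBot ℕ∞ :=
  projectiveDimension
    ((ModuleCat.restrictScalars.{u} D.π).obj (ModuleCat.of D.R' (D.R' ⊗[R] M)))

/-- `pd_Q R'`, which is the length of the regular sequence. -/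
def QuasiDeformation.pdRing {R : Type u} [CommRing R] [IsLocalRing R]
    (D : QuasiDeformation R) : WithBot ℕ∞ :=
  projectiveDimension ((ModuleCat.restrictScalars.{u} D.π).obj (ModuleCat.of D.R' D.R'))

/-- The complete intersection dimension over a local ring, the infimum of
`pd_Q (R' ⊗_R M) - pd_Q R'` over all quasi-deformations `R → R' ← Q`. As `pd_Q R'` is finite, the
difference (which is nonnegative for `M ≠ 0`) is the least `k` with
`pd_Q (R' ⊗_R M) ≤ pd_Q R' + k`. The zero module has complete intersection dimension `0`. -/
def ciDimLocal {R : Type u} [CommRing R] [IsLocalRing R] (M : ModuleCat.{u} R) : ℕ∞ :=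
  sInf {k : ℕ∞ | ∃ D : QuasiDeformation R, D.pdModule M ≤ D.pdRing + (k : WithBot ℕ∞)}

/-- The complete intersection dimension over a Noetherian ring: the supremum of the complete
intersection dimensions of the localizations at the maximal ideals. -/
def ciDim {R : Type u} [CommRing R] (M : ModuleCat.{u} R) : ℕ∞ :=
  ⨆ m : MaximalSpectrum R,
    ciDimLocal (R := Localization.AtPrime m.asIdeal)
      (ModuleCat.of (Localization.AtPrime m.asIdeal)
        (LocalizedModule m.asIdeal.primeCompl M))

/-! ### Perfect modules -/

/-- `G_K`-perfect modules: finitely generated with grade equal to the `G_K`-dimension. -/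
def IsGKPerfect {R : Type u} [CommRing R] (K M : ModuleCat.{u} R) : Prop :=
  Module.Finite R M ∧ grade M = gkDim K M

/-- Perfect modules: finitely generated with grade equal to the projective dimension. -/
def IsPerfect {R : Type u} [CommRing R] (M : ModuleCat.{u} R) : Prop :=
  Module.Finite R M ∧ (grade M : WithBot ℕ∞) = projectiveDimension M

/-- `C`-perfect modules: finitely generated with grade equal to the complete intersection
dimension. -/
def IsCPerfect {R : Type u} [CommRing R] (M : ModuleCat.{u} R) : Prop :=
  Module.Finite R M ∧ grade M = ciDim M

/-- The subcategory of `G_K`-perfect modules of grade `n`. -/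
def gkPerfectOfGrade {R : Type u} [CommRing R] (K : ModuleCat.{u} R) (n : ℕ) :
    ObjectProperty (ModuleCat.{u} R) :=
  fun M => IsGKPerfect K M ∧ grade M = n

/-- The subcategory of perfect modules of grade `n`. -/
def perfectOfGrade (R : Type u) [CommRing R] (n : ℕ) : ObjectProperty (ModuleCat.{u} R) :=
  fun M => IsPerfect M ∧ grade M = n

/-! ### Linkage -/

/-- `φ ∈ Epi(𝒳)`: an epimorphism `φ : X ↠ M` with `X ∈ 𝒳`, `M` finitely generated and
`grade M = grade X`. -/
structure MemEpi {R : Type u} [CommRing R] (𝒳 : ObjectProperty (ModuleCat.{u} R))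
    {X M : ModuleCat.{u} R} (φ : X ⟶ M) : Prop where
  source : 𝒳 X
  finite : Module.Finite R M
  surjective : Function.Surjective φ
  grade_eq : grade M = grade X

/-- The `R`-linear map `Ext^n_R(f, K) : Ext^n_R(Y, K) → Ext^n_R(X, K)`. -/
def extMap {R : Type u} [CommRing R] (K : ModuleCat.{u} R) (n : ℕ) {X Y : ModuleCat.{u} R}
    (f : X ⟶ Y) : Ext Y K n →ₗ[R] Ext X K n :=
  Ext.precompOfLinear (Ext.mk₀ f) R K (zero_add n)

/-- The inclusion `j : ker φ → X`. -/
def kerIncl {R : Type u} [CommRing R] {X M : ModuleCat.{u} R} (φ : X ⟶ M) :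
    ModuleCat.of R (LinearMap.ker φ.hom) ⟶ X :=
  ModuleCat.ofHom (LinearMap.ker φ.hom).subtype

/-- The module `im (Ext^n_R(j, K))`, where `j : ker φ → X` is the inclusion. -/
def linkModule {R : Type u} [CommRing R] (K : ModuleCat.{u} R) (n : ℕ)
    {X M : ModuleCat.{u} R} (φ : X ⟶ M) : ModuleCat.{u} R :=
  ModuleCat.of R (LinearMap.range (extMap K n (kerIncl φ)))

/-- The epimorphism `L_K^n(φ) : Ext^n_R(X, K) ↠ im (Ext^n_R(j, K))` induced by
`Ext^n_R(j, K)`. -/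
def linkMap {R : Type u} [CommRing R] (K : ModuleCat.{u} R) (n : ℕ)
    {X M : ModuleCat.{u} R} (φ : X ⟶ M) :
    ModuleCat.of R (Ext X K n) ⟶ linkModule K n φ :=
  ModuleCat.ofHom (extMap K n (kerIncl φ)).rangeRestrict

/-- Equivalence `φ ≡ ψ` of epimorphisms. -/
def EpiEquiv {R : Type u} [CommRing R] {X M Y N : ModuleCat.{u} R}
    (φ : X ⟶ M) (ψ : Y ⟶ N) : Prop :=
  ∃ (α : M ≅ N) (β : X ≅ Y), φ ≫ α.hom = β.hom ≫ ψ

/-- `M` and `N` are directly linked with respect to `𝒳`: there are `φ, ψ ∈ Epi(𝒳)` with images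
`M` and `N` such that `φ ≡ L_K^n(ψ)` and `ψ ≡ L_K^n(φ)`. -/
def DirectlyLinked {R : Type u} [CommRing R] (K : ModuleCat.{u} R) (n : ℕ)
    (𝒳 : ObjectProperty (ModuleCat.{u} R)) (M N : ModuleCat.{u} R) : Prop :=
  ∃ (X Y : ModuleCat.{u} R) (φ : X ⟶ M) (ψ : Y ⟶ N),
    MemEpi 𝒳 φ ∧ MemEpi 𝒳 ψ ∧ EpiEquiv φ (linkMap K n ψ) ∧ EpiEquiv ψ (linkMap K n φ)

/-- `M` and `N` are linked in `m` steps. -/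
def LinkedInSteps {R : Type u} [CommRing R] (K : ModuleCat.{u} R) (n : ℕ)
    (𝒳 : ObjectProperty (ModuleCat.{u} R)) (m : ℕ) (M N : ModuleCat.{u} R) : Prop :=
  ∃ L : ℕ → ModuleCat.{u} R, L 0 = M ∧ L m = N ∧
    ∀ i < m, DirectlyLinked K n 𝒳 (L i) (L (i + 1))

/-- `M` and `N` are in the same liaison class: they are linked in a positive number of steps. -/
def SameLiaisonClass {R : Type u} [CommRing R] (K : ModuleCat.{u} R) (n : ℕ)
    (𝒳 : ObjectProperty (ModuleCat.{u} R)) (M N : ModuleCat.{u} R) : Prop :=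
  ∃ m : ℕ, 0 < m ∧ LinkedInSteps K n 𝒳 m M N

end

end Liaison

namespace Liaison

noncomputable section


/-! ### Vanishing in the long exact sequences of `Ext` -/

section Vanishing

variable {R : Type u} [CommRing R] {S : ShortComplex (ModuleCat.{u} R)} (hS : S.ShortExact)
include hS

theorem subsingleton_ext_contra₁ (Y : ModuleCat.{u} R) (i : ℕ) (h₂ : Subsingleton (Ext S.X₂ Y i))
    (h₃ : Subsingleton (Ext S.X₃ Y (i + 1))) : Subsingleton (Ext S.X₁ Y i) := by
  refine subsingleton_of_forall_eq 0 fun x => ?_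
  obtain ⟨y, rfl⟩ := Ext.contravariant_sequence_exact₁ hS Y x (add_comm 1 i)
    (Subsingleton.elim _ _)
  rw [Subsingleton.elim y 0, Ext.comp_zero]

theorem subsingleton_ext_contra₂ (Y : ModuleCat.{u} R) (i : ℕ) (h₁ : Subsingleton (Ext S.X₁ Y i))
    (h₃ : Subsingleton (Ext S.X₃ Y i)) : Subsingleton (Ext S.X₂ Y i) := by
  refine subsingleton_of_forall_eq 0 fun x => ?_
  obtain ⟨y, rfl⟩ := Ext.contravariant_sequence_exact₂ hS Y x (Subsingleton.elim _ _)
  rw [Subsingleton.elim y 0, Ext.comp_zero]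

theorem subsingleton_ext_contra₃ (Y : ModuleCat.{u} R) (i : ℕ) (h₁ : Subsingleton (Ext S.X₁ Y i))
    (h₂ : Subsingleton (Ext S.X₂ Y (i + 1))) : Subsingleton (Ext S.X₃ Y (i + 1)) := by
  refine subsingleton_of_forall_eq 0 fun x => ?_
  obtain ⟨y, rfl⟩ := Ext.contravariant_sequence_exact₃ hS Y x (Subsingleton.elim _ _)
    (add_comm 1 i)
  rw [Subsingleton.elim y 0, Ext.comp_zero]

theorem subsingleton_ext_co₁ (X : ModuleCat.{u} R) (i : ℕ) (h₃ : Subsingleton (Ext X S.X₃ i))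
    (h₂ : Subsingleton (Ext X S.X₂ (i + 1))) : Subsingleton (Ext X S.X₁ (i + 1)) := by
  refine subsingleton_of_forall_eq 0 fun x => ?_
  obtain ⟨y, rfl⟩ := Ext.covariant_sequence_exact₁ X hS x (Subsingleton.elim _ _) rfl
  rw [Subsingleton.elim y 0, Ext.zero_comp]

theorem subsingleton_ext_co₁_zero (X : ModuleCat.{u} R) (h₂ : Subsingleton (Ext X S.X₂ 0)) :
    Subsingleton (Ext X S.X₁ 0) := by
  have := hS.mono_f
  exact (Ext.postcomp_mk₀_injective_of_mono X S.f).subsingleton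

theorem subsingleton_ext_co₃ (X : ModuleCat.{u} R) (i : ℕ) (h₂ : Subsingleton (Ext X S.X₂ i))
    (h₁ : Subsingleton (Ext X S.X₁ (i + 1))) : Subsingleton (Ext X S.X₃ i) := by
  refine subsingleton_of_forall_eq 0 fun x => ?_
  obtain ⟨y, rfl⟩ := Ext.covariant_sequence_exact₃ X hS x rfl (Subsingleton.elim _ _)
  rw [Subsingleton.elim y 0, Ext.zero_comp]

end Vanishing

section Transport

variable {R : Type u} [CommRing R]

/-- Isomorphic modules have isomorphic `Ext` modules (first variable). -/
def extCongrLeft {X X' : ModuleCat.{u} R} (e : X ≅ X') (Y : ModuleCat.{u} R) (i : ℕ) :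
    Ext X' Y i ≃ₗ[R] Ext X Y i :=
  LinearEquiv.ofLinearMap (Ext.precompOfLinear (Ext.mk₀ e.hom) R Y (zero_add i))
    (Ext.precompOfLinear (Ext.mk₀ e.inv) R Y (zero_add i))
    (by ext x; simp) (by ext x; simp)

/-- Isomorphic modules have isomorphic `Ext` modules (second variable). -/
def extCongrRight (X : ModuleCat.{u} R) {Y Y' : ModuleCat.{u} R} (e : Y ≅ Y') (i : ℕ) :
    Ext X Y i ≃ₗ[R] Ext X Y' i :=
  LinearEquiv.ofLinearMap (Ext.postcompOfLinear (Ext.mk₀ e.hom) R X (add_zero i))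
    (Ext.postcompOfLinear (Ext.mk₀ e.inv) R X (add_zero i))
    (by ext x; simp) (by ext x; simp)

/-- `Ext^0` is `Hom`. -/
def extZeroEquiv (X Y : ModuleCat.{u} R) : Ext X Y 0 ≃ₗ[R] (X →ₗ[R] Y) :=
  (Ext.linearEquiv₀ (R := R)).trans ModuleCat.homLinearEquiv

theorem mk₀_ofHom_extZeroEquiv {X Y : ModuleCat.{u} R} (x : Ext X Y 0) :
    Ext.mk₀ (ModuleCat.ofHom (extZeroEquiv X Y x)) = x :=
  Ext.mk₀_linearEquiv₀_apply (R := R) x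

theorem extZeroEquiv_mk₀ {X Y : ModuleCat.{u} R} (f : X ⟶ Y) :
    extZeroEquiv X Y (Ext.mk₀ f) = f.hom := by
  apply (extZeroEquiv X Y).symm.injective
  rw [LinearEquiv.symm_apply_apply]
  rfl

theorem shortExact_of_exact {A B C : ModuleCat.{u} R} (f : A ⟶ B) (g : B ⟶ C) (w : f ≫ g = 0)
    (hf : Function.Injective f) (hfg : Function.Exact f g) (hg : Function.Surjective g) :
    (ShortComplex.mk f g w).ShortExact where
  exact := (ShortComplex.ShortExact.moduleCat_exact_iff_function_exact _).mpr hfg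
  mono_f := (ModuleCat.mono_iff_injective _).mpr hf
  epi_g := (ModuleCat.epi_iff_surjective _).mpr hg

end Transport

/-! ### Resolutions by a class of modules and dimension shifting -/

section Resolution

variable {R : Type u} [CommRing R]

/-- `HasRes 𝒢 k M`: there is an exact sequence `0 → G_k → ⋯ → G_0 → M → 0` with all `G_i` in `𝒢`. -/
inductive HasRes (𝒢 : ObjectProperty (ModuleCat.{u} R)) : ℕ → ModuleCat.{u} R → Prop
  | zero {M : ModuleCat.{u} R} (hM : 𝒢 M) : HasRes 𝒢 0 M
  | succ {k : ℕ} {S : ShortComplex (ModuleCat.{u} R)} (hS : S.ShortExact)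
      (hG : 𝒢 S.X₂) (h : HasRes 𝒢 k S.X₁) : HasRes 𝒢 (k + 1) S.X₃

/-- The map `Ext^n(X, A) → Ext^n(X, B)` induced by `f : A ⟶ B`. -/
abbrev extPost (X : ModuleCat.{u} R) {A B : ModuleCat.{u} R} (f : A ⟶ B) (n : ℕ) :
    ModuleCat.of R (Ext X A n) ⟶ ModuleCat.of R (Ext X B n) :=
  ModuleCat.ofHom (Ext.postcompOfLinear (Ext.mk₀ f) R X (add_zero n))

/-- The map `Ext^n(Y, A) → Ext^n(X, A)` induced by `f : X ⟶ Y`. -/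
abbrev extPre {X Y : ModuleCat.{u} R} (f : X ⟶ Y) (A : ModuleCat.{u} R) (n : ℕ) :
    ModuleCat.of R (Ext Y A n) ⟶ ModuleCat.of R (Ext X A n) :=
  ModuleCat.ofHom (Ext.precompOfLinear (Ext.mk₀ f) R A (zero_add n))

/-- The connecting map `Ext^n(S.X₁, A) → Ext^(n+1)(S.X₃, A)`. -/
abbrev extDelta {S : ShortComplex (ModuleCat.{u} R)} (hS : S.ShortExact) (A : ModuleCat.{u} R)
    (n : ℕ) : ModuleCat.of R (Ext S.X₁ A n) ⟶ ModuleCat.of R (Ext S.X₃ A (n + 1)) :=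
  ModuleCat.ofHom (Ext.precompOfLinear hS.extClass R A (add_comm 1 n))

theorem extPre_comp_extPost {X Y : ModuleCat.{u} R} (f : X ⟶ Y) {A B : ModuleCat.{u} R}
    (g : A ⟶ B) (n : ℕ) : extPre f A n ≫ extPost X g n = extPost Y g n ≫ extPre f B n := by
  ext x
  exact Ext.comp_assoc _ _ _ (zero_add n) (add_zero n) (by omega)

theorem extDelta_comp_extPost {S : ShortComplex (ModuleCat.{u} R)} (hS : S.ShortExact)
    {A B : ModuleCat.{u} R} (g : A ⟶ B) (n : ℕ) :
    extDelta hS A n ≫ extPost S.X₃ g (n + 1) = extPost S.X₁ g n ≫ extDelta hS B n := by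
  ext x
  exact Ext.comp_assoc _ _ _ (add_comm 1 n) (add_zero n) (by omega)

section SES

variable {S : ShortComplex (ModuleCat.{u} R)} (hS : S.ShortExact) (A : ModuleCat.{u} R)

include hS in
theorem extPre_g_injective : Function.Injective (extPre S.g A 0) := by
  have := hS.epi_g
  exact Ext.precomp_mk₀_injective_of_epi A S.g

include hS in
theorem extPre_exact (n : ℕ) : Function.Exact (extPre S.g A n) (extPre S.f A n) := by
  intro x
  constructor
  · intro hx
    exact Ext.contravariant_sequence_exact₂ hS A x hx
  · rintro ⟨y, rfl⟩
    change (Ext.mk₀ S.f).comp ((Ext.mk₀ S.g).comp y (zero_add n)) (zero_add n) = 0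
    rw [Ext.mk₀_comp_mk₀_assoc, S.zero, Ext.mk₀_zero, Ext.zero_comp]

theorem extPre_extDelta_exact (n : ℕ) : Function.Exact (extPre S.f A n) (extDelta hS A n) := by
  intro x
  constructor
  · intro hx
    exact Ext.contravariant_sequence_exact₁ hS A x (add_comm 1 n) hx
  · rintro ⟨y, rfl⟩
    exact hS.extClass_comp_assoc y (h := add_comm 1 n)

theorem extDelta_extPre_exact (n : ℕ) :
    Function.Exact (extDelta hS A n) (extPre S.g A (n + 1)) := by
  intro x
  constructor
  · intro hx
    exact Ext.contravariant_sequence_exact₃ hS A x hx (add_comm 1 n)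
  · rintro ⟨y, rfl⟩
    exact hS.comp_extClass_assoc y (add_comm 1 n)

theorem extDelta_surjective (n : ℕ) (h : Subsingleton (Ext S.X₂ A (n + 1))) :
    Function.Surjective (extDelta hS A n) := fun x =>
  (extDelta_extPre_exact hS A n x).1 (Subsingleton.elim (α := Ext S.X₂ A (n + 1)) _ _)

theorem extDelta_injective (n : ℕ) (h : Subsingleton (Ext S.X₂ A n)) :
    Function.Injective (extDelta hS A n) := by
  rw [injective_iff_map_eq_zero]
  intro x hx
  obtain ⟨y, rfl⟩ := (extPre_extDelta_exact hS A n x).1 hx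
  rw [Subsingleton.elim (α := Ext S.X₂ A n) y 0, map_zero]

include hS in
theorem extPre_f_surjective (n : ℕ) (h : Subsingleton (Ext S.X₃ A (n + 1))) :
    Function.Surjective (extPre S.f A n) := fun x =>
  (extPre_extDelta_exact hS A n x).1 (Subsingleton.elim (α := Ext S.X₃ A (n + 1)) _ _)

/-- Dimension shifting along a short exact sequence with acyclic middle term. -/
def extShift (n : ℕ) (h : Subsingleton (Ext S.X₂ A n)) (h' : Subsingleton (Ext S.X₂ A (n + 1))) :
    ModuleCat.of R (Ext S.X₁ A n) ≅ ModuleCat.of R (Ext S.X₃ A (n + 1)) :=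
  (LinearEquiv.ofBijective (extDelta hS A n).hom
    ⟨extDelta_injective hS A n h, extDelta_surjective hS A n h'⟩).toModuleIso

end SES

/-- A family of properties of morphisms which is inherited by the successive cosyzygies in the
`A`-dual and the `B`-dual of a resolution by modules in `𝒢`. -/
structure IsCosyzygyStable (𝒢 : ObjectProperty (ModuleCat.{u} R)) {A B : ModuleCat.{u} R}
    (f : A ⟶ B) (Φ : ℕ → ∀ {U V : ModuleCat.{u} R}, (U ⟶ V) → Prop) : Prop where
  acyclic_left {G : ModuleCat.{u} R} (hG : 𝒢 G) (i : ℕ) (hi : 0 < i) : Subsingleton (Ext G A i)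
  acyclic_right {G : ModuleCat.{u} R} (hG : 𝒢 G) (i : ℕ) (hi : 0 < i) : Subsingleton (Ext G B i)
  zero {U V : ModuleCat.{u} R} (g : U ⟶ V) (hU : Subsingleton U) (hV : Subsingleton V) : Φ 0 g
  iso {j : ℕ} {U V U' V' : ModuleCat.{u} R} (g : U ⟶ V) (g' : U' ⟶ V') (e : U ≅ U') (e' : V ≅ V')
    (w : e.hom ≫ g' = g ≫ e'.hom) (h : Φ j g) : Φ j g'
  step {j : ℕ} {G : ModuleCat.{u} R} (hG : 𝒢 G) {U V U' V' : ModuleCat.{u} R} (g : U ⟶ V)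
    (g' : U' ⟶ V') (i : U ⟶ ModuleCat.of R (Ext G A 0)) (p : ModuleCat.of R (Ext G A 0) ⟶ U')
    (w : i ≫ p = 0) (hS : (ShortComplex.mk i p w).ShortExact)
    (i' : V ⟶ ModuleCat.of R (Ext G B 0)) (p' : ModuleCat.of R (Ext G B 0) ⟶ V')
    (w' : i' ≫ p' = 0) (hS' : (ShortComplex.mk i' p' w').ShortExact)
    (hi : i ≫ extPost G f 0 = g ≫ i') (hp : p ≫ g' = extPost G f 0 ≫ p')
    (h : Φ j g) : Φ (j + 1) g'

variable {𝒢 : ObjectProperty (ModuleCat.{u} R)} {A B : ModuleCat.{u} R} {f : A ⟶ B}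
  {Φ : ℕ → ∀ {U V : ModuleCat.{u} R}, (U ⟶ V) → Prop}

namespace IsCosyzygyStable

variable (H : IsCosyzygyStable 𝒢 f Φ)
include H

theorem ext_zero {S : ShortComplex (ModuleCat.{u} R)} (hS : S.ShortExact) (hG : 𝒢 S.X₂)
    (hA : Subsingleton (Ext S.X₃ A 1)) (hB : Subsingleton (Ext S.X₃ B 1)) {j : ℕ}
    (h : Φ j (extPost S.X₃ f 0)) : Φ (j + 1) (extPost S.X₁ f 0) := by
  have key (D : ModuleCat.{u} R) (hD : Subsingleton (Ext S.X₃ D 1)) :=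
    shortExact_of_exact (extPre S.g D 0) (extPre S.f D 0)
    (by ext x; exact (extPre_exact hS D 0).apply_apply_eq_zero x)
    (extPre_g_injective hS D) (extPre_exact hS D 0) (extPre_f_surjective hS D 0 hD)
  exact H.step hG _ _ _ _ _ (key A hA) _ _ _ (key B hB) (extPre_comp_extPost _ _ _)
    (extPre_comp_extPost _ _ _) h

theorem ext_one {S : ShortComplex (ModuleCat.{u} R)} (hS : S.ShortExact) (hG : 𝒢 S.X₂)
    (hG₁ : 𝒢 S.X₁) {j : ℕ} (h : Φ j (extPost S.X₃ f 0)) :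
    Φ (j + 2) (extPost S.X₃ f 1) := by
  let Z (D : ModuleCat.{u} R) := ModuleCat.of R (LinearMap.range (extPre S.f D 0).hom)
  have hw : ∀ x : Ext S.X₂ A 0, extPost S.X₁ f 0 (extPre S.f A 0 x) =
      extPre S.f B 0 (extPost S.X₂ f 0 x) := fun x =>
    congr($(extPre_comp_extPost S.f f 0) x)
  let z : Z A ⟶ Z B := ModuleCat.ofHom ((extPost S.X₁ f 0).hom.restrict (by
    rintro _ ⟨x, rfl⟩
    exact ⟨extPost S.X₂ f 0 x, (hw x).symm⟩))
  have k₁ (D : ModuleCat.{u} R) :=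
    shortExact_of_exact (extPre S.g D 0) (ModuleCat.ofHom (extPre S.f D 0).hom.rangeRestrict :
      _ ⟶ Z D)
    (by ext x; exact (extPre_exact hS D 0).apply_apply_eq_zero x)
    (extPre_g_injective hS D)
    (by
      intro x
      rw [← extPre_exact hS D 0 x]
      exact Subtype.ext_iff)
    (LinearMap.surjective_rangeRestrict _)
  have k₂ (D : ModuleCat.{u} R) (hD : Subsingleton (Ext S.X₂ D 1)) :=
    shortExact_of_exact (ModuleCat.ofHom (LinearMap.range (extPre S.f D 0).hom).subtype :
      Z D ⟶ _) (extDelta hS D 0)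
    (by
      ext ⟨_, x, rfl⟩
      exact (extPre_extDelta_exact hS D 0).apply_apply_eq_zero x)
    Subtype.val_injective
    (by
      intro x
      rw [extPre_extDelta_exact hS D 0 x]
      constructor
      · rintro ⟨y, rfl⟩
        exact ⟨⟨_, y, rfl⟩, rfl⟩
      · rintro ⟨⟨_, y, rfl⟩, rfl⟩
        exact ⟨y, rfl⟩)
    (extDelta_surjective hS D 0 hD)
  have h₁ : Φ (j + 1) z := by
    refine H.step hG _ _ _ _ _ (k₁ A) _ _ _ (k₁ B) (extPre_comp_extPost _ _ _) ?_ h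
    ext x
    exact hw x
  exact H.step hG₁ _ _ _ _ _ (k₂ A (H.acyclic_left hG 1 one_pos)) _ _ _
    (k₂ B (H.acyclic_right hG 1 one_pos)) rfl (extDelta_comp_extPost hS f 0) h₁

theorem ext_succ_of_ext_zero {k : ℕ} {X : ModuleCat.{u} R} (hX : HasRes 𝒢 (k + 1) X)
    (hA : ∀ i, 0 < i → i < k + 1 → Subsingleton (Ext X A i))
    (hB : ∀ i, 0 < i → i < k + 1 → Subsingleton (Ext X B i)) {j : ℕ}
    (h : Φ j (extPost X f 0)) : Φ (j + k + 2) (extPost X f (k + 1)) := by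
  induction k generalizing X j with
  | zero =>
    obtain _ | ⟨hS, hG, h₁⟩ := hX
    obtain ⟨hG₁⟩ := h₁
    exact H.ext_one hS hG hG₁ h
  | succ k ih =>
    obtain _ | ⟨hS, hG, h₁⟩ := hX
    rename_i S
    have aA := H.acyclic_left hG
    have aB := H.acyclic_right hG
    have := ih h₁
      (fun i hi hik => subsingleton_ext_contra₁ hS A i (aA i hi) (hA _ (by omega) (by omega)))
      (fun i hi hik => subsingleton_ext_contra₁ hS B i (aB i hi) (hB _ (by omega) (by omega)))
      (H.ext_zero hS hG (hA 1 (by omega) (by omega)) (hB 1 (by omega) (by omega)) h)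
    rw [show j + (k + 1) + 2 = j + 1 + k + 2 by omega]
    exact H.iso _ _ (extShift hS A (k + 1) (aA _ (by omega)) (aA _ (by omega)))
      (extShift hS B (k + 1) (aB _ (by omega)) (aB _ (by omega)))
      (extDelta_comp_extPost hS f (k + 1)) this

/-- If `X` has a resolution of length `n` and `Ext^i(X, A) = 0 = Ext^i(X, B)` for `i < n`, then
`Ext^n(X, f)` is the last cosyzygy of the dual of the resolution. -/
theorem ext {n : ℕ} {X : ModuleCat.{u} R} (hX : HasRes 𝒢 n X)
    (hA : ∀ i < n, Subsingleton (Ext X A i)) (hB : ∀ i < n, Subsingleton (Ext X B i)) :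
    Φ (n + 1) (extPost X f n) := by
  obtain _ | n := n
  · obtain ⟨hG⟩ := hX
    have k (D : ModuleCat.{u} R) := shortExact_of_exact
      (0 : ModuleCat.of R PUnit ⟶ ModuleCat.of R (Ext X D 0)) (𝟙 _) (by simp)
      (fun _ _ _ => Subsingleton.elim _ _)
      (by
        intro x
        constructor
        · intro hx
          exact ⟨0, (map_zero _).trans hx.symm⟩
        · rintro ⟨y, rfl⟩
          rfl) Function.surjective_id
    refine H.step hG (0 : ModuleCat.of R PUnit ⟶ ModuleCat.of R PUnit) _ _ _ _ (k A) _ _ _ (k B)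
      (by simp) (by simp) (H.zero _ (inferInstanceAs (Subsingleton PUnit))
        (inferInstanceAs (Subsingleton PUnit)))
  · have := H.ext_succ_of_ext_zero hX (fun i _ hi => hA i hi) (fun i _ hi => hB i hi) (j := 0)
      (H.zero _ (hA 0 (by omega)) (hB 0 (by omega)))
    rwa [zero_add] at this

end IsCosyzygyStable

end Resolution


/-! ### Regular sequences and `Ext` -/

section RegularQuotient

variable {R : Type u} [CommRing R]

/-- `RegQuot rs A B`: the list `rs` is a weakly `A`-regular sequence and `B ≅ A / (rs) A`. -/
inductive RegQuot : List R → ModuleCat.{u} R → ModuleCat.{u} R → Prop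
  | nil {A B : ModuleCat.{u} R} (e : A ≅ B) : RegQuot [] A B
  | cons {x : R} {rs : List R} {A B C : ModuleCat.{u} R} (hx : IsSMulRegular A x) (p : A ⟶ C)
      (hp : Function.Surjective p) (hk : ∀ a, p a = 0 ↔ ∃ b : A, x • b = a) (h : RegQuot rs C B) :
      RegQuot (x :: rs) A B

theorem shortExact_smul {x : R} {A C : ModuleCat.{u} R} (hx : IsSMulRegular A x) (p : A ⟶ C)
    (hp : Function.Surjective p) (hk : ∀ a, p a = 0 ↔ ∃ b : A, x • b = a) :
    (ShortComplex.mk (x • 𝟙 A) p (by ext a; exact (hk _).2 ⟨a, rfl⟩)).ShortExact :=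
  shortExact_of_exact _ _ _ hx (fun a => hk a) hp

theorem smul_ext_eq_zero {V A : ModuleCat.{u} R} {x : R} (hx : x ∈ Module.annihilator R V) {i : ℕ}
    (y : Ext V A i) : x • y = 0 := by
  have h : x • 𝟙 V = 0 := by
    ext v
    exact Module.mem_annihilator.1 hx v
  rw [← Ext.mk₀_id_comp y, ← Ext.smul_comp, ← Ext.mk₀_smul, h, Ext.mk₀_zero, Ext.zero_comp]

theorem ext_comp_smul_eq_zero {V A : ModuleCat.{u} R} {x : R} (hx : x ∈ Module.annihilator R V)
    {i : ℕ} (y : Ext V A i) : y.comp (Ext.mk₀ (x • 𝟙 A)) (add_zero i) = 0 := by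
  rw [← Ext.smul_eq_comp_mk₀, smul_ext_eq_zero hx]

namespace RegQuot

theorem subsingleton_ext {rs : List R} {A B : ModuleCat.{u} R} (h : RegQuot rs A B)
    {V : ModuleCat.{u} R} (hV : ∀ r ∈ rs, r ∈ Module.annihilator R V) (i : ℕ)
    (hi : i < rs.length) : Subsingleton (Ext V A i) := by
  induction h generalizing i with
  | nil => simp at hi
  | @cons x rs A B C hx p hp hk h ih =>
    have hS := shortExact_smul hx p hp hk
    refine subsingleton_of_forall_eq 0 fun y => ?_
    have hy := ext_comp_smul_eq_zero (hV x List.mem_cons_self) y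
    obtain _ | i := i
    · have := hS.mono_f
      exact (injective_iff_map_eq_zero _).1 (Ext.postcomp_mk₀_injective_of_mono V _) y hy
    · obtain ⟨z, rfl⟩ := Ext.covariant_sequence_exact₁ V hS y hy rfl
      have := ih (fun r hr => hV r (List.mem_cons_of_mem _ hr)) i (by simpa using hi)
      rw [Subsingleton.elim (α := Ext V C i) z 0, Ext.zero_comp]

theorem exists_ext {rs : List R} {A B : ModuleCat.{u} R} (h : RegQuot rs A B) :
    ∃ θ : Ext B A rs.length, ∀ V : ModuleCat.{u} R, (∀ r ∈ rs, r ∈ Module.annihilator R V) →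
      Function.Bijective (Ext.postcompOfLinear θ R V (zero_add rs.length)) := by
  induction h with
  | @nil A B e =>
    exact ⟨Ext.mk₀ e.inv, fun V _ => (extCongrRight V e.symm 0).bijective⟩
  | @cons x rs A B C hx p hp hk h ih =>
    obtain ⟨θ, hθ⟩ := ih
    have hS := shortExact_smul hx p hp hk
    refine ⟨θ.comp hS.extClass rfl, fun V hV => ?_⟩
    have hV' : ∀ r ∈ rs, r ∈ Module.annihilator R V := fun r hr =>
      hV r (List.mem_cons_of_mem _ hr)
    have e : Ext.postcompOfLinear (θ.comp hS.extClass rfl) R V (zero_add _) =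
        (Ext.postcompOfLinear hS.extClass R V (rfl : rs.length + 1 = _)).comp
          (Ext.postcompOfLinear θ R V (zero_add _)) := by
      ext y
      exact (Ext.comp_assoc y θ hS.extClass (zero_add _) rfl (by omega)).symm
    suffices h' : Function.Bijective
        (Ext.postcompOfLinear hS.extClass R V (rfl : rs.length + 1 = _)) by
      have := h'.comp (hθ V hV')
      rw [← LinearMap.coe_comp, ← e] at this
      exact this
    refine ⟨?_, fun y => ?_⟩
    · rw [injective_iff_map_eq_zero]
      intro y hy
      obtain ⟨z, rfl⟩ := Ext.covariant_sequence_exact₃ V hS y rfl hy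
      have : Subsingleton (Ext V A rs.length) :=
        (RegQuot.cons hx p hp hk h).subsingleton_ext hV _ (by simp)
      rw [Subsingleton.elim z 0, Ext.zero_comp]
    · obtain ⟨z, hz⟩ := Ext.covariant_sequence_exact₁ V hS y
        (ext_comp_smul_eq_zero (hV x List.mem_cons_self) y) rfl
      exact ⟨z, hz⟩

end RegQuot

end RegularQuotient

/-! ### Regular sequences from the vanishing of `Ext` -/

section Rees

variable {R : Type u} [CommRing R]

theorem extPost_exact {S : ShortComplex (ModuleCat.{u} R)} (hS : S.ShortExact)
    (V : ModuleCat.{u} R) (n : ℕ) : Function.Exact (extPost V S.f n) (extPost V S.g n) := by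
  intro x
  constructor
  · intro hx
    exact Ext.covariant_sequence_exact₂ V hS x hx
  · rintro ⟨y, rfl⟩
    change Ext.comp (Ext.comp y (Ext.mk₀ S.f) (add_zero n)) (Ext.mk₀ S.g) (add_zero n) = 0
    rw [Ext.comp_assoc_of_third_deg_zero, Ext.mk₀_comp_mk₀, S.zero, Ext.mk₀_zero, Ext.comp_zero]

theorem extPost_surjective {S : ShortComplex (ModuleCat.{u} R)} (hS : S.ShortExact)
    (V : ModuleCat.{u} R) (n : ℕ) (h : Subsingleton (Ext V S.X₁ (n + 1))) :
    Function.Surjective (extPost V S.g n) := fun x =>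
  Ext.covariant_sequence_exact₃ V hS x rfl (Subsingleton.elim _ _)

theorem extPost_injective {S : ShortComplex (ModuleCat.{u} R)} (hS : S.ShortExact)
    (V : ModuleCat.{u} R) (n : ℕ) (h : Subsingleton (Ext V S.X₃ n)) :
    Function.Injective (extPost V S.f (n + 1)) := by
  rw [injective_iff_map_eq_zero]
  intro x hx
  obtain ⟨y, rfl⟩ := Ext.covariant_sequence_exact₁ V hS x hx rfl
  rw [Subsingleton.elim y 0, Ext.zero_comp]

theorem extPost_injective_zero {S : ShortComplex (ModuleCat.{u} R)} (hS : S.ShortExact)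
    (V : ModuleCat.{u} R) : Function.Injective (extPost V S.f 0) := by
  have := hS.mono_f
  exact Ext.postcomp_mk₀_injective_of_mono V S.f

theorem shortExact_ext_zero {S : ShortComplex (ModuleCat.{u} R)} (hS : S.ShortExact)
    (V : ModuleCat.{u} R) (h : Subsingleton (Ext V S.X₁ 1)) :
    (ShortComplex.mk (extPost V S.f 0) (extPost V S.g 0)
      (by ext x; exact (extPost_exact hS V 0).apply_apply_eq_zero x)).ShortExact :=
  shortExact_of_exact _ _ _ (extPost_injective_zero hS V) (extPost_exact hS V 0)
    (extPost_surjective hS V 0 h)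

variable [IsNoetherianRing R]

theorem exists_mem_annihilator_isSMulRegular {K X B : ModuleCat.{u} R} [Module.Finite R K]
    [Module.Finite R X] [Module.Finite R B] (hK : Module.annihilator R K = ⊥)
    (h : Subsingleton (Ext X (ModuleCat.of R (Ext K B 0)) 0)) :
    ∃ x ∈ Module.annihilator R X, IsSMulRegular B x := by
  have h₁ : Subsingleton (X →ₗ[R] K →ₗ[R] B) :=
    ((extCongrRight X (extZeroEquiv K B).toModuleIso 0).trans
      (extZeroEquiv X _)).symm.injective.subsingleton
  have h₂ : Subsingleton (K →ₗ[R] X →ₗ[R] B) := ⟨fun a b => by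
    have := Subsingleton.elim a.flip b.flip
    rw [← LinearMap.flip_flip a, this, LinearMap.flip_flip]⟩
  obtain ⟨r, hr, hreg⟩ := IsSMulRegular.subsingleton_linearMap_iff.1 h₂
  rw [hK, Submodule.mem_bot] at hr
  subst hr
  have := IsSMulRegular.zero_iff_subsingleton.1 hreg
  exact IsSMulRegular.subsingleton_linearMap_iff.1 this

theorem exists_regQuot_of_subsingleton_ext {K X : ModuleCat.{u} R} [Module.Finite R K]
    [Module.Finite R X] (hK : Module.annihilator R K = ⊥) (n : ℕ) (B : ModuleCat.{u} R)
    [Module.Finite R B] (hB : ∀ i, 0 < i → Subsingleton (Ext K B i))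
    (h : ∀ i < n, Subsingleton (Ext X (ModuleCat.of R (Ext K B 0)) i)) :
    ∃ (rs : List R) (C : ModuleCat.{u} R), rs.length = n ∧
      (∀ r ∈ rs, r ∈ Module.annihilator R X) ∧ RegQuot rs B C := by
  induction n generalizing B with
  | zero => exact ⟨[], B, rfl, by simp, .nil (Iso.refl B)⟩
  | succ n ih =>
    obtain ⟨x, hx, hreg⟩ := exists_mem_annihilator_isSMulRegular hK (h 0 n.succ_pos)
    let C := ModuleCat.of R (B ⧸ LinearMap.range (LinearMap.lsmul R B x))
    let p : B ⟶ C := ModuleCat.ofHom (Submodule.mkQ _)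
    have hp : Function.Surjective p := Submodule.mkQ_surjective _
    have hk : ∀ a, p a = 0 ↔ ∃ b : B, x • b = a := fun a =>
      Submodule.Quotient.mk_eq_zero _
    have hS := shortExact_smul hreg p hp hk
    have : Module.Finite R C := Module.Finite.of_surjective p.hom hp
    obtain ⟨rs, D, hl, hrs, hD⟩ := ih C
      (fun i hi => subsingleton_ext_co₃ hS K i (hB i hi) (hB _ (by omega)))
      (fun i hi => subsingleton_ext_co₃ (shortExact_ext_zero hS K (hB 1 one_pos)) X i
        (h i (by omega)) (h (i + 1) (by omega)))
    refine ⟨x :: rs, D, by simp [hl], ?_, .cons hreg p hp hk hD⟩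
    simpa [hx] using hrs

namespace IsSemidualizing

variable {K : ModuleCat.{u} R} (hK : IsSemidualizing K)
include hK

omit [IsNoetherianRing R] in
theorem annihilator_eq_bot : Module.annihilator R K = ⊥ := by
  rw [eq_bot_iff]
  intro r hr
  refine hK.homothety_bijective.1 (LinearMap.ext fun k => ?_)
  exact (Module.mem_annihilator.1 hr k).trans (zero_smul R k).symm

theorem exists_regQuot {X : ModuleCat.{u} R} [Module.Finite R X] {n : ℕ}
    (h : ∀ i < n, Subsingleton (Ext X (ModuleCat.of R R) i)) :
    ∃ (rs : List R) (C : ModuleCat.{u} R), rs.length = n ∧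
      (∀ r ∈ rs, r ∈ Module.annihilator R X) ∧ RegQuot rs K C := by
  have := hK.finite
  refine exists_regQuot_of_subsingleton_ext hK.annihilator_eq_bot n K hK.ext_self fun i hi => ?_
  have e : ModuleCat.of R R ≅ ModuleCat.of R (Ext K K 0) :=
    ((LinearEquiv.ofBijective _ hK.homothety_bijective).trans
      (extZeroEquiv K K).symm).toModuleIso
  have := h i hi
  exact (extCongrRight X e i).symm.injective.subsingleton

end IsSemidualizing

omit [IsNoetherianRing R] in
theorem isSemidualizing_self : IsSemidualizing (ModuleCat.of R R) where
  finite := inferInstanceAs (Module.Finite R R)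
  homothety_bijective := by
    constructor
    · intro a b h
      simpa using LinearMap.congr_fun h (1 : R)
    · intro f
      refine ⟨f (1 : R), LinearMap.ext_ring ?_⟩
      simp
  ext_self i hi := by
    obtain ⟨i, rfl⟩ := Nat.exists_eq_succ_of_ne_zero hi.ne'
    have : Projective (ModuleCat.of R R) :=
      (IsProjective.iff_projective _).1 (inferInstanceAs (Module.Projective R R))
    exact Ext.subsingleton_of_projective _ _ i

end Rees


/-! ### Totally reflexive modules -/

section TotallyReflexive

variable {R : Type u} [CommRing R] {K : ModuleCat.{u} R}

/-- The dual `Hom_R(M, K)` as an object of the category of modules. -/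
abbrev dual (K M : ModuleCat.{u} R) : ModuleCat.{u} R := ModuleCat.of R (M →ₗ[R] K)

/-- The dual of a map. -/
abbrev dualMap (K : ModuleCat.{u} R) {M N : ModuleCat.{u} R} (f : M ⟶ N) : dual K N ⟶ dual K M :=
  ModuleCat.ofHom (LinearMap.lcomp R K f.hom)

/-- The dual of a short complex. -/
abbrev dualComplex (K : ModuleCat.{u} R) (S : ShortComplex (ModuleCat.{u} R)) :
    ShortComplex (ModuleCat.{u} R) :=
  ShortComplex.mk (dualMap K S.g) (dualMap K S.f) (by
    ext f x
    exact (congrArg f (S.moduleCat_zero_apply x)).trans (map_zero f))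

theorem dualComplex_shortExact {S : ShortComplex (ModuleCat.{u} R)} (hS : S.ShortExact)
    (h : Subsingleton (Ext S.X₃ K 1)) : (dualComplex K S).ShortExact := by
  have hex := (ShortComplex.ShortExact.moduleCat_exact_iff_function_exact _).1 hS.exact
  have hg := (ModuleCat.epi_iff_surjective _).1 hS.epi_g
  refine shortExact_of_exact _ _ _ ?_ ?_ ?_
  · exact LinearMap.lcomp_injective_of_surjective S.g.hom hg
  · exact LinearMap.exact_lcomp_of_exact_of_surjective _ hex hg
  · intro f
    obtain ⟨y, hy⟩ := extPre_f_surjective hS K 0 h (Ext.mk₀ (ModuleCat.ofHom f))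
    refine ⟨extZeroEquiv _ _ y, ?_⟩
    apply (extZeroEquiv S.X₁ K).symm.injective
    refine Eq.trans ?_ (hy.trans ?_)
    · conv_rhs => rw [← mk₀_ofHom_extZeroEquiv y]
      exact (Ext.mk₀_comp_mk₀ _ _).symm
    · rfl

theorem isTotallyReflexive_of_subsingleton (K : ModuleCat.{u} R) {M : ModuleCat.{u} R}
    (hM : Subsingleton M) : IsTotallyReflexive K M where
  finite := inferInstance
  eval_bijective := by
    have : Subsingleton (dual K M) := ⟨fun f g => LinearMap.ext fun x => by
      rw [Subsingleton.elim x 0, map_zero, map_zero]⟩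
    have : Subsingleton (dual K (dual K M)) := ⟨fun f g => LinearMap.ext fun x => by
      rw [Subsingleton.elim x 0, map_zero, map_zero]⟩
    exact ⟨fun _ _ _ => Subsingleton.elim _ _, fun y => ⟨0, Subsingleton.elim _ _⟩⟩
  ext_eq_zero i _ := by
    have := (ModuleCat.isZero_of_subsingleton M).hasProjectiveDimensionLT_zero
    exact HasProjectiveDimensionLT.subsingleton M 0 i (by omega) K
  ext_dual_eq_zero i _ := by
    have : Subsingleton (dual K M) := ⟨fun f g => LinearMap.ext fun x => by
      rw [Subsingleton.elim x 0, map_zero, map_zero]⟩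
    have := (ModuleCat.isZero_of_subsingleton (dual K M)).hasProjectiveDimensionLT_zero
    exact HasProjectiveDimensionLT.subsingleton (dual K M) 0 i (by omega) K

theorem shortExact_prod (M N : ModuleCat.{u} R) :
    (ShortComplex.mk (ModuleCat.ofHom (LinearMap.inl R M N)) (ModuleCat.ofHom (LinearMap.snd R M N))
      (by ext x; rfl)).ShortExact :=
  shortExact_of_exact _ _ _ LinearMap.inl_injective Function.Exact.inl_snd
    LinearMap.snd_surjective

section FiveLemma

variable {S T : ShortComplex (ModuleCat.{u} R)} (hS : S.ShortExact) (hT : T.ShortExact)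
  (a : S.X₁ →ₗ[R] T.X₁) (b : S.X₂ →ₗ[R] T.X₂) (c : S.X₃ →ₗ[R] T.X₃)
  (hab : ∀ x, b (S.f x) = T.f (a x)) (hbc : ∀ x, c (S.g x) = T.g (b x))
include hS hT hab hbc

theorem bijective₁_of_shortExact (hb : Function.Bijective b) (hc : Function.Injective c) :
    Function.Bijective a := by
  have hS₁ := (ModuleCat.mono_iff_injective _).1 hS.mono_f
  have hT₁ := (ModuleCat.mono_iff_injective _).1 hT.mono_f
  have hSe := (ShortComplex.ShortExact.moduleCat_exact_iff_function_exact _).1 hS.exact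
  constructor
  · intro x y h
    apply hS₁
    apply hb.1
    rw [hab, hab, h]
  · intro y
    obtain ⟨z, hz⟩ := hb.2 (T.f y)
    have : S.g z = 0 := hc (by rw [hbc, hz, T.moduleCat_zero_apply, map_zero])
    obtain ⟨x, rfl⟩ := (hSe z).1 this
    exact ⟨x, hT₁ (by rw [← hab, hz])⟩

theorem bijective₂_of_shortExact (ha : Function.Bijective a) (hc : Function.Bijective c) :
    Function.Bijective b := by
  have hT₁ := (ModuleCat.mono_iff_injective _).1 hT.mono_f
  have hS₃ := (ModuleCat.epi_iff_surjective _).1 hS.epi_g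
  have hSe := (ShortComplex.ShortExact.moduleCat_exact_iff_function_exact _).1 hS.exact
  have hTe := (ShortComplex.ShortExact.moduleCat_exact_iff_function_exact _).1 hT.exact
  constructor
  · rw [injective_iff_map_eq_zero]
    intro x hx
    have : S.g x = 0 := hc.1 (by rw [hbc, hx, map_zero, map_zero])
    obtain ⟨w, rfl⟩ := (hSe x).1 this
    have : w = 0 := ha.1 (hT₁ (by rw [← hab, hx, map_zero, map_zero]))
    rw [this, map_zero]
  · intro y
    obtain ⟨z, hz⟩ := hc.2 (T.g y)
    obtain ⟨x, rfl⟩ := hS₃ z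
    obtain ⟨w, hw⟩ := (hTe (y - b x)).1 (by rw [map_sub, ← hbc, hz, sub_self])
    obtain ⟨v, rfl⟩ := ha.2 w
    exact ⟨x + S.f v, by rw [map_add, hab, hw, add_sub_cancel]⟩

theorem bijective₃_of_shortExact (ha : Function.Surjective a) (hb : Function.Bijective b) :
    Function.Bijective c := by
  have hS₃ := (ModuleCat.epi_iff_surjective _).1 hS.epi_g
  have hT₃ := (ModuleCat.epi_iff_surjective _).1 hT.epi_g
  have hTe := (ShortComplex.ShortExact.moduleCat_exact_iff_function_exact _).1 hT.exact
  constructor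
  · rw [injective_iff_map_eq_zero]
    intro z hz
    obtain ⟨x, rfl⟩ := hS₃ z
    obtain ⟨w, hw⟩ := (hTe (b x)).1 (by rw [← hbc, hz])
    obtain ⟨v, rfl⟩ := ha w
    have : S.f v = x := hb.1 (by rw [hab, hw])
    rw [← this, S.moduleCat_zero_apply]
  · intro y
    obtain ⟨w, rfl⟩ := hT₃ y
    obtain ⟨x, rfl⟩ := hb.2 w
    exact ⟨S.g x, hbc x⟩

end FiveLemma

namespace IsTotallyReflexive

theorem middle {S : ShortComplex (ModuleCat.{u} R)} (hS : S.ShortExact)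
    (h₁ : IsTotallyReflexive K S.X₁) (h₃ : IsTotallyReflexive K S.X₃) :
    IsTotallyReflexive K S.X₂ := by
  have hD := dualComplex_shortExact hS (h₃.ext_eq_zero 1 one_pos)
  have hDD := dualComplex_shortExact hD (h₁.ext_dual_eq_zero 1 one_pos)
  have hex := (ShortComplex.ShortExact.moduleCat_exact_iff_function_exact _).1 hS.exact
  have hg := (ModuleCat.epi_iff_surjective _).1 hS.epi_g
  have := h₁.finite
  have := h₃.finite
  exact
  { finite := by
      have : Module.Finite R (LinearMap.ker S.g.hom) := by
        rw [LinearMap.exact_iff.1 hex]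
        infer_instance
      have : Module.Finite R (S.X₂ ⧸ LinearMap.ker S.g.hom) :=
        Module.Finite.equiv (S.g.hom.quotKerEquivOfSurjective hg).symm
      exact Module.Finite.of_submodule_quotient (LinearMap.ker S.g.hom)
    eval_bijective := bijective₂_of_shortExact hS hDD (evalMap K _) (evalMap K _) (evalMap K _)
      (fun x => rfl) (fun x => rfl) h₁.eval_bijective h₃.eval_bijective
    ext_eq_zero := fun i hi => subsingleton_ext_contra₂ hS K i (h₁.ext_eq_zero i hi)
      (h₃.ext_eq_zero i hi)
    ext_dual_eq_zero := fun i hi => subsingleton_ext_contra₂ hD K i (h₃.ext_dual_eq_zero i hi)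
      (h₁.ext_dual_eq_zero i hi) }

theorem of_iso {M N : ModuleCat.{u} R} (e : M ≅ N) (h : IsTotallyReflexive K M) :
    IsTotallyReflexive K N := by
  have hS := shortExact_of_exact e.hom (0 : N ⟶ ModuleCat.of R PUnit) (by simp)
    e.toLinearEquiv.injective
    (fun x => ⟨fun _ => e.toLinearEquiv.surjective x, fun _ => rfl⟩)
    (fun x => ⟨0, Subsingleton.elim (α := PUnit) _ _⟩)
  exact middle hS h (isTotallyReflexive_of_subsingleton K (inferInstanceAs (Subsingleton PUnit)))

theorem product {M N : ModuleCat.{u} R} (h : IsTotallyReflexive K M) (h' : IsTotallyReflexive K N) :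
    IsTotallyReflexive K (ModuleCat.of R (M × N)) :=
  middle (shortExact_prod M N) h h'

variable [IsNoetherianRing R]

theorem kernel {S : ShortComplex (ModuleCat.{u} R)} (hS : S.ShortExact)
    (h₂ : IsTotallyReflexive K S.X₂) (h₃ : IsTotallyReflexive K S.X₃) :
    IsTotallyReflexive K S.X₁ := by
  have hD := dualComplex_shortExact hS (h₃.ext_eq_zero 1 one_pos)
  have hg := (ModuleCat.epi_iff_surjective _).1 hS.epi_g
  have h1 : Subsingleton (Ext (dual K S.X₁) K 1) := by
    have key : Function.Surjective (dualMap K (dualMap K S.g)) := by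
      intro y
      obtain ⟨z, rfl⟩ := h₃.eval_bijective.2 y
      obtain ⟨x, rfl⟩ := hg z
      exact ⟨evalMap K _ x, rfl⟩
    refine subsingleton_of_forall_eq 0 fun x => ?_
    obtain ⟨y, rfl⟩ := extDelta_surjective hD K 0 (h₂.ext_dual_eq_zero 1 one_pos) x
    obtain ⟨z, hz⟩ := key (extZeroEquiv _ _ y)
    refine (extPre_extDelta_exact hD K 0 y).2 ⟨Ext.mk₀ (ModuleCat.ofHom z), ?_⟩
    change (Ext.mk₀ _).comp (Ext.mk₀ _) (zero_add 0) = _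
    rw [Ext.mk₀_comp_mk₀, ← mk₀_ofHom_extZeroEquiv y, ← hz]
    rfl
  have hDD := dualComplex_shortExact hD h1
  have := h₂.finite
  exact
  { finite := Module.Finite.of_injective S.f.hom ((ModuleCat.mono_iff_injective _).1 hS.mono_f)
    eval_bijective := bijective₁_of_shortExact hS hDD (evalMap K _) (evalMap K _) (evalMap K _)
      (fun x => rfl) (fun x => rfl) h₂.eval_bijective h₃.eval_bijective.1
    ext_eq_zero := fun i hi => subsingleton_ext_contra₁ hS K i (h₂.ext_eq_zero i hi)
      (h₃.ext_eq_zero _ (by omega))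
    ext_dual_eq_zero := fun i hi => by
      obtain _ | _ | i := i
      · omega
      · exact h1
      · exact subsingleton_ext_contra₃ hD K (i + 1) (h₃.ext_dual_eq_zero _ (by omega))
          (h₂.ext_dual_eq_zero _ (by omega)) }

omit [IsNoetherianRing R] in
theorem cokernel {S : ShortComplex (ModuleCat.{u} R)} (hS : S.ShortExact)
    (h₁ : IsTotallyReflexive K S.X₁) (h₂ : IsTotallyReflexive K S.X₂)
    (h : Subsingleton (Ext S.X₃ K 1)) : IsTotallyReflexive K S.X₃ := by
  have hD := dualComplex_shortExact hS h
  have hDD := dualComplex_shortExact hD (h₁.ext_dual_eq_zero 1 one_pos)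
  have := h₂.finite
  exact
  { finite := Module.Finite.of_surjective S.g.hom ((ModuleCat.epi_iff_surjective _).1 hS.epi_g)
    eval_bijective := bijective₃_of_shortExact hS hDD (evalMap K _) (evalMap K _) (evalMap K _)
      (fun x => rfl) (fun x => rfl) h₁.eval_bijective.2 h₂.eval_bijective
    ext_eq_zero := fun i hi => by
      obtain _ | _ | i := i
      · omega
      · exact h
      · exact subsingleton_ext_contra₃ hS K (i + 1) (h₁.ext_eq_zero _ (by omega))
          (h₂.ext_eq_zero _ (by omega))
    ext_dual_eq_zero := fun i hi => subsingleton_ext_contra₁ hD K i (h₂.ext_dual_eq_zero i hi)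
      (h₁.ext_dual_eq_zero _ (by omega)) }

theorem dual {M : ModuleCat.{u} R} (h : IsTotallyReflexive K M) (hK : Module.Finite R K) :
    IsTotallyReflexive K (dual K M) where
  finite := by
    have := h.finite
    exact inferInstanceAs (Module.Finite R (M →ₗ[R] K))
  eval_bijective := by
    have h₁ : Function.Bijective (dualMap K (ModuleCat.ofHom (evalMap K M) :
        M ⟶ Liaison.dual K (Liaison.dual K M))) :=
      ((LinearEquiv.ofBijective _ h.eval_bijective).congrLeft K R).symm.bijective
    refine (Function.Bijective.of_comp_iff' h₁ _).1 ?_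
    exact Function.bijective_id
  ext_eq_zero := h.ext_dual_eq_zero
  ext_dual_eq_zero i hi := by
    have := h.ext_eq_zero i hi
    let e : M ≅ Liaison.dual K (Liaison.dual K M) :=
      (LinearEquiv.ofBijective _ h.eval_bijective).toModuleIso
    exact (extCongrLeft e K i).injective.subsingleton

theorem ext_zero {M : ModuleCat.{u} R} (h : IsTotallyReflexive K M) (hK : Module.Finite R K) :
    IsTotallyReflexive K (ModuleCat.of R (Ext M K 0)) :=
  (h.dual hK).of_iso (extZeroEquiv M K).symm.toModuleIso

end IsTotallyReflexive

namespace IsSemidualizing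

variable (hK : IsSemidualizing K)
include hK

theorem isTotallyReflexive_self : IsTotallyReflexive K (ModuleCat.of R R) where
  finite := inferInstanceAs (Module.Finite R R)
  eval_bijective := by
    have h : Function.Bijective (dualMap K (ModuleCat.ofHom
        (LinearMap.ringLmapEquivSelf R R K).toLinearMap :
        Liaison.dual K (ModuleCat.of R R) ⟶ K)) :=
      ((LinearMap.ringLmapEquivSelf R R K).congrLeft K R).symm.bijective
    convert h.comp hK.homothety_bijective using 1
    ext r f
    change f r = r • f (1 : R)
    rw [← map_smul, smul_eq_mul, mul_one]
  ext_eq_zero i hi := by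
    obtain ⟨i, rfl⟩ := Nat.exists_eq_succ_of_ne_zero hi.ne'
    have : Projective (ModuleCat.of R R) :=
      (IsProjective.iff_projective _).1 (inferInstanceAs (Module.Projective R R))
    exact Ext.subsingleton_of_projective _ _ i
  ext_dual_eq_zero i hi := by
    have := hK.ext_self i hi
    let e : Liaison.dual K (ModuleCat.of R R) ≅ K := (LinearMap.ringLmapEquivSelf R R K).toModuleIso
    exact (extCongrLeft e K i).symm.injective.subsingleton

theorem isTotallyReflexive_fin (n : ℕ) : IsTotallyReflexive K (ModuleCat.of R (Fin n → R)) := by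
  induction n with
  | zero => exact isTotallyReflexive_of_subsingleton K (inferInstanceAs (Subsingleton (_ → R)))
  | succ n ih =>
    exact (hK.isTotallyReflexive_self.product ih).of_iso
      (Fin.consLinearEquiv R (fun _ : Fin (n + 1) => R)).toModuleIso

end IsSemidualizing

end TotallyReflexive


/-! ### Modules of finite Gorenstein dimension -/

section FiniteDimension

variable {R : Type u} [CommRing R]

/-- The kernel of a map, as an object of the category of modules. -/
abbrev kernelObj {M N : ModuleCat.{u} R} (f : M ⟶ N) : ModuleCat.{u} R :=
  ModuleCat.of R (LinearMap.ker f.hom)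

theorem shortExact_kernel {M N : ModuleCat.{u} R} (f : M ⟶ N) (hf : Function.Surjective f) :
    (ShortComplex.mk (kerIncl f) f (by ext x; exact x.2)).ShortExact :=
  shortExact_of_exact _ _ _ Subtype.val_injective (fun x => ⟨fun h => ⟨⟨x, h⟩, rfl⟩, by
    rintro ⟨y, rfl⟩
    exact y.2⟩) hf

/-- The first term of a short exact sequence is the kernel of the second map. -/
def kernelIso {S : ShortComplex (ModuleCat.{u} R)} (hS : S.ShortExact) :
    S.X₁ ≅ kernelObj S.g :=
  (LinearEquiv.ofBijective
    (S.f.hom.codRestrict (LinearMap.ker S.g.hom) (fun x => S.moduleCat_zero_apply x))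
    ⟨fun x y h => (ModuleCat.mono_iff_injective _).1 hS.mono_f (congrArg Subtype.val h), fun x => by
      obtain ⟨y, hy⟩ :=
        ((ShortComplex.ShortExact.moduleCat_exact_iff_function_exact _).1 hS.exact _).1 x.2
      exact ⟨y, Subtype.ext hy⟩⟩).toModuleIso

namespace HasRes

variable {𝒢 : ObjectProperty (ModuleCat.{u} R)}

theorem of_iso (h𝒢 : ∀ {M N : ModuleCat.{u} R}, (M ≅ N) → 𝒢 M → 𝒢 N) {k : ℕ}
    {M N : ModuleCat.{u} R} (h : HasRes 𝒢 k M) (e : M ≅ N) : HasRes 𝒢 k N := by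
  cases h with
  | zero hM => exact .zero (h𝒢 e hM)
  | @succ k S hS hG h =>
    have hex := (ShortComplex.ShortExact.moduleCat_exact_iff_function_exact _).1 hS.exact
    have hg := (ModuleCat.epi_iff_surjective _).1 hS.epi_g
    have he : Function.Bijective e.hom := e.toLinearEquiv.bijective
    have hS' := shortExact_of_exact S.f (S.g ≫ e.hom)
      (by rw [← Category.assoc, S.zero, Limits.zero_comp])
      ((ModuleCat.mono_iff_injective _).1 hS.mono_f)
      (fun x => by
        rw [← hex x]
        exact ⟨fun h => he.1 (h.trans (map_zero _).symm),
          fun h => (congrArg e.hom h).trans (map_zero _)⟩)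
      (he.2.comp hg)
    exact .succ hS' hG h

theorem of_zero {M : ModuleCat.{u} R} (h : HasRes 𝒢 0 M) : 𝒢 M := by
  cases h with
  | zero hM => exact hM

theorem exists_kernel (h𝒢 : ∀ {M N : ModuleCat.{u} R}, (M ≅ N) → 𝒢 M → 𝒢 N) {k : ℕ}
    {M : ModuleCat.{u} R} (h : HasRes 𝒢 (k + 1) M) :
    ∃ (G : ModuleCat.{u} R) (p : G ⟶ M), Function.Surjective p ∧ 𝒢 G ∧
      HasRes 𝒢 k (kernelObj p) := by
  cases h with
  | @succ k S hS hG h =>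
    exact ⟨S.X₂, S.g, (ModuleCat.epi_iff_surjective _).1 hS.epi_g, hG, h.of_iso h𝒢 (kernelIso hS)⟩

theorem succ_kernel {k : ℕ} {G M : ModuleCat.{u} R} (p : G ⟶ M) (hp : Function.Surjective p)
    (hG : 𝒢 G) (h : HasRes 𝒢 k (kernelObj p)) : HasRes 𝒢 (k + 1) M :=
  HasRes.succ (shortExact_kernel p hp) hG h

theorem finite (h𝒢 : ∀ {M : ModuleCat.{u} R}, 𝒢 M → Module.Finite R M) {k : ℕ}
    {M : ModuleCat.{u} R} (h : HasRes 𝒢 k M) : Module.Finite R M := by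
  cases h with
  | zero hM => exact h𝒢 hM
  | @succ k S hS hG h =>
    have := h𝒢 hG
    exact Module.Finite.of_surjective S.g.hom ((ModuleCat.epi_iff_surjective _).1 hS.epi_g)

theorem subsingleton_ext {A : ModuleCat.{u} R}
    (h𝒢 : ∀ {M : ModuleCat.{u} R}, 𝒢 M → ∀ i, 0 < i → Subsingleton (Ext M A i)) {k : ℕ}
    {M : ModuleCat.{u} R} (h : HasRes 𝒢 k M) (i : ℕ) (hi : k < i) :
    Subsingleton (Ext M A i) := by
  induction h generalizing i with
  | zero hM => exact h𝒢 hM i hi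
  | @succ k S hS hG h ih =>
    obtain _ | i := i
    · omega
    · exact subsingleton_ext_contra₃ hS A i (ih i (by omega)) (h𝒢 hG _ (by omega))

end HasRes

theorem hasGKResolution_iff {K : ModuleCat.{u} R} {k : ℕ} {M : ModuleCat.{u} R} :
    HasGKResolution K k M ↔ HasRes (IsTotallyReflexive K) k M := by
  constructor <;> intro h
  · induction h with
    | zero hM => exact .zero hM
    | succ hS hG _ ih => exact .succ hS hG ih
  · induction h with
    | zero hM => exact .zero hM
    | succ hS hG _ ih => exact .succ hS hG ih

variable {K : ModuleCat.{u} R}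

theorem HasRes.prod_totallyReflexive {k : ℕ} {M P : ModuleCat.{u} R}
    (h : HasRes (IsTotallyReflexive K) k M) (hP : IsTotallyReflexive K P) :
    HasRes (IsTotallyReflexive K) k (ModuleCat.of R (M × P)) := by
  obtain _ | k := k
  · obtain ⟨hM⟩ := h
    exact .zero (hM.product hP)
  · obtain ⟨G, p, hp, hG, h⟩ := h.exists_kernel IsTotallyReflexive.of_iso
    let i : kernelObj p ⟶ ModuleCat.of R (G × P) :=
      ModuleCat.ofHom ((LinearMap.inl R G P).comp (LinearMap.ker p.hom).subtype)
    let q : ModuleCat.of R (G × P) ⟶ ModuleCat.of R (M × P) :=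
      ModuleCat.ofHom (p.hom.prodMap LinearMap.id)
    have hS := shortExact_of_exact i q
      (by
        ext x
        · exact x.2
        · rfl)
      (fun x y h => Subtype.ext (congrArg Prod.fst h))
      (by
        rintro ⟨g, y⟩
        constructor
        · intro hx
          obtain ⟨h₁, h₂⟩ := Prod.ext_iff.1 hx
          exact ⟨⟨g, h₁⟩, Prod.ext rfl h₂.symm⟩
        · rintro ⟨x, hx⟩
          rw [← hx]
          exact Prod.ext x.2 rfl)
      (fun x => by
        obtain ⟨g, hg⟩ := hp x.1
        exact ⟨(g, x.2), Prod.ext hg rfl⟩)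
    exact .succ hS (hG.product hP) h

variable [IsNoetherianRing R]

theorem HasRes.kernel_totallyReflexive {k : ℕ} {B G : ModuleCat.{u} R} (q : B ⟶ G)
    (hq : Function.Surjective q) (h : HasRes (IsTotallyReflexive K) k B)
    (hG : IsTotallyReflexive K G) : HasRes (IsTotallyReflexive K) k (kernelObj q) := by
  obtain _ | k := k
  · obtain ⟨hB⟩ := h
    exact .zero (IsTotallyReflexive.kernel (shortExact_kernel q hq) hB hG)
  · obtain ⟨H, p, hp, hH, h⟩ := h.exists_kernel IsTotallyReflexive.of_iso
    have hH' := IsTotallyReflexive.kernel (shortExact_kernel (p ≫ q) (hq.comp hp)) hH hG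
    have hle : LinearMap.ker p.hom ≤ LinearMap.ker (p ≫ q).hom := fun x hx =>
      (congrArg q hx).trans (map_zero q.hom)
    let i : kernelObj p ⟶ kernelObj (p ≫ q) :=
      ModuleCat.ofHom (Submodule.inclusion hle)
    let r : kernelObj (p ≫ q) ⟶ kernelObj q :=
      ModuleCat.ofHom (p.hom.restrict (fun x hx => hx))
    have hS := shortExact_of_exact i r
      (by ext x; exact x.2)
      (Submodule.inclusion_injective hle)
      (by
        rintro ⟨x, hx⟩
        constructor
        · intro h
          exact ⟨⟨x, congrArg Subtype.val h⟩, rfl⟩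
        · rintro ⟨y, hy⟩
          rw [← hy]
          exact Subtype.ext y.2)
      (by
        rintro ⟨x, hx⟩
        obtain ⟨y, rfl⟩ := hp x
        exact ⟨⟨y, hx⟩, rfl⟩)
    exact .succ hS hH' h

/-- A syzygy of a module of finite `G_K`-dimension with respect to a projective cover. -/
theorem HasRes.syzygy {k : ℕ} {M F : ModuleCat.{u} R} (π : F ⟶ M) (hπ : Function.Surjective π)
    (h : HasRes (IsTotallyReflexive K) (k + 1) M) (hF : IsTotallyReflexive K F)
    (hproj : Module.Projective R F) : HasRes (IsTotallyReflexive K) k (kernelObj π) := by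
  obtain ⟨G, p, hp, hG, h⟩ := h.exists_kernel IsTotallyReflexive.of_iso
  obtain ⟨l, hl⟩ := Module.projective_lifting_property p.hom π.hom hp
  have hl' : ∀ f, p.hom (l f) = π.hom f := fun f => LinearMap.congr_fun hl f
  let q : ModuleCat.of R (kernelObj p × F) ⟶ G :=
    ModuleCat.ofHom ((LinearMap.ker p.hom).subtype.coprod l)
  have hq : Function.Surjective q := by
    intro g
    obtain ⟨f, hf⟩ := hπ (p g)
    exact ⟨(⟨g - l f, by
      rw [LinearMap.mem_ker, map_sub, hl', sub_eq_zero]; exact hf.symm⟩, f), sub_add_cancel _ _⟩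
  have hker : ∀ x : kernelObj q, x.1.2 ∈ LinearMap.ker π.hom := by
    rintro ⟨⟨⟨m, hm⟩, f⟩, hx⟩
    have hx' : m + l f = 0 := hx
    have := congrArg p.hom hx'
    rw [map_add, hl', map_zero, LinearMap.mem_ker.1 hm, zero_add] at this
    exact this
  refine (kernel_totallyReflexive q hq (h.prod_totallyReflexive hF) hG).of_iso
    IsTotallyReflexive.of_iso (LinearEquiv.ofBijective
      (((LinearMap.snd R (kernelObj p) F).comp (LinearMap.ker q.hom).subtype).codRestrict _ hker)
      ⟨?_, ?_⟩).toModuleIso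
  · rw [injective_iff_map_eq_zero]
    rintro ⟨⟨⟨m, hm⟩, f⟩, hx⟩ h
    have hf : f = 0 := congrArg Subtype.val h
    subst hf
    have hx' : m + l 0 = 0 := hx
    rw [map_zero, add_zero] at hx'
    subst hx'
    rfl
  · rintro ⟨f, hf⟩
    refine ⟨⟨(⟨-l f, ?_⟩, f), neg_add_cancel _⟩, rfl⟩
    rw [LinearMap.mem_ker, map_neg, hl', LinearMap.mem_ker.1 hf, neg_zero]

/-- The kernel of an epimorphism between modules of `G_K`-dimension at most `k`. -/
theorem HasRes.kernel (hK : IsSemidualizing K) {k : ℕ} {S : ShortComplex (ModuleCat.{u} R)}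
    (hS : S.ShortExact) (h₂ : HasRes (IsTotallyReflexive K) k S.X₂)
    (h₃ : HasRes (IsTotallyReflexive K) k S.X₃) : HasRes (IsTotallyReflexive K) k S.X₁ := by
  induction k generalizing S with
  | zero =>
    exact .zero (IsTotallyReflexive.kernel hS h₂.of_zero h₃.of_zero)
  | succ k ih =>
    have hS₁ := (ModuleCat.mono_iff_injective _).1 hS.mono_f
    have hS₃ := (ModuleCat.epi_iff_surjective _).1 hS.epi_g
    have hSe := (ShortComplex.ShortExact.moduleCat_exact_iff_function_exact _).1 hS.exact
    have := h₂.finite (fun h => h.finite)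
    have : Module.Finite R S.X₁ := Module.Finite.of_injective S.f.hom hS₁
    have := h₃.finite (fun h => h.finite)
    obtain ⟨r, a, ha⟩ := Module.Finite.exists_fin' R S.X₁
    obtain ⟨s, b, hb⟩ := Module.Finite.exists_fin' R S.X₃
    obtain ⟨l, hl⟩ := Module.projective_lifting_property S.g.hom b hS₃
    have hl' : ∀ f, S.g.hom (l f) = b f := fun f => LinearMap.congr_fun hl f
    let a' : ModuleCat.of R (Fin r → R) ⟶ S.X₁ := ModuleCat.ofHom a
    let b' : ModuleCat.of R (Fin s → R) ⟶ S.X₃ := ModuleCat.ofHom b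
    let c : ModuleCat.of R ((Fin r → R) × (Fin s → R)) ⟶ S.X₂ :=
      ModuleCat.ofHom ((S.f.hom.comp a).coprod l)
    have hcg : ∀ x : (Fin r → R) × (Fin s → R), S.g.hom (c.hom x) = b x.2 := fun x => by
      refine (map_add S.g.hom _ _).trans ?_
      refine (congrArg _ (hl' x.2)).trans ?_
      exact (congrArg (· + b x.2) (S.moduleCat_zero_apply (a x.1))).trans (zero_add _)
    have hc : Function.Surjective c := by
      intro x
      obtain ⟨y, hy⟩ := hb (S.g x)
      obtain ⟨z, hz⟩ := (hSe (x - l y)).1 (by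
        refine (map_sub S.g.hom _ _).trans ?_
        rw [hl', hy, sub_eq_zero])
      obtain ⟨w, rfl⟩ := ha z
      refine ⟨(w, y), ?_⟩
      change S.f (a w) + l y = x
      rw [hz, sub_add_cancel]
    have kb := h₃.syzygy b' hb (hK.isTotallyReflexive_fin s)
      (inferInstanceAs (Module.Projective R (Fin s → R)))
    have kc := h₂.syzygy c hc ((hK.isTotallyReflexive_fin r).product (hK.isTotallyReflexive_fin s))
      (inferInstanceAs (Module.Projective R ((Fin r → R) × (Fin s → R))))
    let i : kernelObj a' ⟶ kernelObj c := ModuleCat.ofHom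
      ((LinearMap.inl R (Fin r → R) (Fin s → R)).restrict (fun x hx => by
        have hx' : a x = 0 := hx
        change S.f.hom (a x) + l 0 = 0
        rw [hx', map_zero, map_zero, add_zero]))
    let q : kernelObj c ⟶ kernelObj b' := ModuleCat.ofHom
      ((LinearMap.snd R (Fin r → R) (Fin s → R)).restrict (fun x hx => by
        have hx' : c.hom x = 0 := hx
        have := hcg x
        rw [hx', map_zero] at this
        exact this.symm))
    have hT := shortExact_of_exact i q (by ext x; rfl)
      (fun x y h => Subtype.ext (congrArg (fun z => z.1.1) h))
      (by
        rintro ⟨⟨x, y⟩, hx⟩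
        constructor
        · intro h
          have hy : y = 0 := congrArg Subtype.val h
          subst hy
          have hx' : S.f.hom (a x) + l 0 = 0 := hx
          rw [map_zero, add_zero] at hx'
          exact ⟨⟨x, hS₁ (hx'.trans (map_zero _).symm)⟩, rfl⟩
        · rintro ⟨z, hz⟩
          rw [← hz]
          rfl)
      (by
        rintro ⟨y, hy⟩
        have hy' : b y = 0 := hy
        obtain ⟨z, hz⟩ := (hSe (l y)).1 ((hl' y).trans hy')
        obtain ⟨w, rfl⟩ := ha z
        refine ⟨⟨(-w, y), ?_⟩, rfl⟩
        change S.f.hom (a (-w)) + l y = 0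
        rw [← hz, map_neg, map_neg]
        exact neg_add_cancel _)
    exact .succ_kernel a' ha (hK.isTotallyReflexive_fin r) (ih hT kc kb)

omit [IsNoetherianRing R] in
theorem HasRes.isTotallyReflexive {k : ℕ} {M : ModuleCat.{u} R}
    (h : HasRes (IsTotallyReflexive K) k M) (hM : ∀ i, 0 < i → Subsingleton (Ext M K i)) :
    IsTotallyReflexive K M := by
  induction h with
  | zero h => exact h
  | @succ k S hS hG h ih =>
    exact IsTotallyReflexive.cokernel hS (ih fun i hi => subsingleton_ext_contra₁ hS K i
      (hG.ext_eq_zero i hi) (hM _ (by omega))) hG (hM 1 one_pos)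

omit [IsNoetherianRing R] in
theorem HasRes.subsingleton {k : ℕ} {M : ModuleCat.{u} R}
    (h : HasRes (IsTotallyReflexive K) k M) (hM : ∀ i, Subsingleton (Ext M K i)) :
    Subsingleton M := by
  have ht := h.isTotallyReflexive fun i _ => hM i
  have h₀ := hM 0
  have : Subsingleton (M →ₗ[R] K) := (extZeroEquiv M K).symm.injective.subsingleton
  have : Subsingleton ((M →ₗ[R] K) →ₗ[R] K) := ⟨fun f g => LinearMap.ext fun x => by
    rw [Subsingleton.elim x 0, map_zero, map_zero]⟩
  exact ht.eval_bijective.1.subsingleton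

/-- If `Ext^i(M, K) = 0` for `i < n` and `M` has `G_K`-dimension at most `n`, then so has
`Ext^n(M, K)`. -/
theorem HasRes.ext (hK : Module.Finite R K) {n : ℕ} {M : ModuleCat.{u} R}
    (h : HasRes (IsTotallyReflexive K) n M) (hM : ∀ i < n, Subsingleton (Ext M K i)) :
    HasRes (IsTotallyReflexive K) n (ModuleCat.of R (Ext M K n)) := by
  let Φ : ℕ → ∀ {U V : ModuleCat.{u} R}, (U ⟶ V) → Prop := fun j U _ _ =>
    match j with
    | 0 => Subsingleton U
    | j + 1 => HasRes (IsTotallyReflexive K) j U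
  have H : IsCosyzygyStable (IsTotallyReflexive K) (𝟙 K) Φ :=
    { acyclic_left := fun hG => hG.ext_eq_zero
      acyclic_right := fun hG => hG.ext_eq_zero
      zero := fun _ h _ => h
      iso := fun {j} {U V U' V'} g g' e e' w h => by
        obtain _ | j := j
        · have : Subsingleton U := h
          exact e.toLinearEquiv.symm.injective.subsingleton
        · exact HasRes.of_iso IsTotallyReflexive.of_iso h e
      step := fun {j} {G} hG {U V U' V'} g g' i p w hS i' p' w' hS' hi hp h => by
        obtain _ | j := j
        · have hU : Subsingleton U := h
          have hp := (ModuleCat.epi_iff_surjective _).1 hS.epi_g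
          have hex := (ShortComplex.ShortExact.moduleCat_exact_iff_function_exact _).1 hS.exact
          refine HasRes.zero ((hG.ext_zero hK).of_iso
            (LinearEquiv.ofBijective p.hom ⟨?_, hp⟩).toModuleIso)
          rw [injective_iff_map_eq_zero]
          intro x hx
          obtain ⟨y, rfl⟩ := (hex x).1 hx
          rw [Subsingleton.elim (α := U) y 0, map_zero]
        · exact HasRes.succ hS (hG.ext_zero hK) h }
  exact H.ext h hM hM

end FiniteDimension


/-! ### Grade and `G_K`-dimension along linkage -/

section Linkage

variable {R : Type u} [CommRing R]

theorem subsingleton_ext_of_lt_grade {M : ModuleCat.{u} R} {i : ℕ} (hi : (i : ℕ∞) < grade M) :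
    Subsingleton (Ext M (ModuleCat.of R R) i) := by
  by_contra h
  rw [not_subsingleton_iff_nontrivial] at h
  exact absurd (iInf₂_le i h) (not_le.2 hi)

theorem nontrivial_of_grade_eq {M : ModuleCat.{u} R} {n : ℕ} (h : grade M = n) :
    Nontrivial M := by
  by_contra hM
  rw [not_nontrivial_iff_subsingleton] at hM
  have : grade M = ⊤ := by
    refine iInf₂_eq_top.2 fun i hi => absurd hi ?_
    rw [not_nontrivial_iff_subsingleton]
    have := (ModuleCat.isZero_of_subsingleton M).hasProjectiveDimensionLT_zero
    exact HasProjectiveDimensionLT.subsingleton M 0 i (by omega) _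
  rw [this] at h
  exact ENat.top_ne_natCast n h

theorem hasGKResolution_of_gkDim_eq {K M : ModuleCat.{u} R} {n : ℕ} (h : gkDim K M = n) :
    HasGKResolution K n M := by
  have hlt : gkDim K M < ((n + 1 : ℕ) : ℕ∞) := by
    rw [h]
    exact_mod_cast n.lt_succ_self
  obtain ⟨k, hk⟩ := iInf_lt_iff.1 hlt
  obtain ⟨hres, hk⟩ := iInf_lt_iff.1 hk
  have h₁ : gkDim K M ≤ k := iInf₂_le k hres
  rw [h] at h₁
  have : k = n := le_antisymm (Nat.lt_succ_iff.1 (by exact_mod_cast hk)) (by exact_mod_cast h₁)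
  exact this ▸ hres

/-- The link is all of `Ext^n_R(ker φ, K)` if `Ext^{n+1}_R(M, K) = 0`. -/
theorem linkModule_iso {K : ModuleCat.{u} R} {n : ℕ} {X M : ModuleCat.{u} R} (φ : X ⟶ M)
    (hφ : Function.Surjective φ) (h : Subsingleton (Ext M K (n + 1))) :
    Nonempty (linkModule K n φ ≅ ModuleCat.of R (Ext (kernelObj φ) K n)) := by
  have hsurj := extPre_f_surjective (shortExact_kernel φ hφ) K n h
  exact ⟨(LinearEquiv.ofTop _ (LinearMap.range_eq_top.2 hsurj)).toModuleIso⟩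

theorem annihilator_le_kernelObj {X M : ModuleCat.{u} R} (φ : X ⟶ M) :
    Module.annihilator R X ≤ Module.annihilator R (kernelObj φ) :=
  LinearMap.annihilator_le_of_injective _ (LinearMap.ker φ.hom).injective_subtype

theorem DirectlyLinked.symm {K : ModuleCat.{u} R} {n : ℕ} {𝒳 : ObjectProperty (ModuleCat.{u} R)}
    {M N : ModuleCat.{u} R} (h : DirectlyLinked K n 𝒳 M N) : DirectlyLinked K n 𝒳 N M := by
  obtain ⟨X, Y, φ, ψ, hφ, hψ, h₁, h₂⟩ := h
  exact ⟨Y, X, ψ, φ, hψ, hφ, h₂, h₁⟩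

theorem SameLiaisonClass.iff_of_directlyLinked {K : ModuleCat.{u} R} {n : ℕ}
    {𝒳 : ObjectProperty (ModuleCat.{u} R)} {P : ModuleCat.{u} R → Prop}
    (hP : ∀ {M N : ModuleCat.{u} R}, DirectlyLinked K n 𝒳 M N → P M → P N)
    {M N : ModuleCat.{u} R} (h : SameLiaisonClass K n 𝒳 M N) : P M ↔ P N := by
  obtain ⟨m, -, L, rfl, rfl, hL⟩ := h
  induction m with
  | zero => rfl
  | succ m ih =>
    refine (ih fun i hi => hL i (by omega)).trans ?_
    have := hL m (by omega)
    exact ⟨hP this, hP this.symm⟩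

variable [IsNoetherianRing R]

theorem HasRes.le_of_subsingleton_ext {K : ModuleCat.{u} R} (hK : IsSemidualizing K) {k n : ℕ}
    {N : ModuleCat.{u} R} [Nontrivial N] (h : HasRes (IsTotallyReflexive K) k N)
    (hN : ∀ i < n, Subsingleton (Ext N (ModuleCat.of R R) i)) : n ≤ k := by
  by_contra hlt
  have := h.finite fun h => h.finite
  obtain ⟨rs, C, rfl, hrs, hC⟩ := hK.exists_regQuot hN
  refine not_subsingleton N (h.subsingleton fun i => ?_)
  obtain hi | hi := lt_or_ge i rs.length
  · exact hC.subsingleton_ext hrs i hi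
  · exact h.subsingleton_ext (fun h => h.ext_eq_zero) i (by omega)

theorem isGKPerfect_of_hasRes {K : ModuleCat.{u} R} (hK : IsSemidualizing K) {n : ℕ}
    {N : ModuleCat.{u} R} (hN : grade N = n) (h : HasRes (IsTotallyReflexive K) n N) :
    IsGKPerfect K N := by
  refine ⟨h.finite fun h => h.finite, le_antisymm ?_ ?_⟩
  · have := nontrivial_of_grade_eq hN
    refine le_iInf₂ fun k hk => ?_
    rw [hN]
    exact_mod_cast (hasGKResolution_iff.1 hk).le_of_subsingleton_ext hK fun i hi =>
      subsingleton_ext_of_lt_grade (by rw [hN]; exact_mod_cast hi)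
  · rw [hN]
    exact iInf₂_le n (hasGKResolution_iff.2 h)

theorem DirectlyLinked.isGKPerfect {K : ModuleCat.{u} R} (hK : IsSemidualizing K) {n : ℕ}
    {M N : ModuleCat.{u} R} (h : DirectlyLinked K n (gkPerfectOfGrade K n) M N)
    (hM : IsGKPerfect K M) : IsGKPerfect K N := by
  obtain ⟨X, Y, φ, ψ, hφ, hψ, -, α, -, -⟩ := h
  have hXn := hφ.source.2
  have hMn := hφ.grade_eq.trans hXn
  have hNn := hψ.grade_eq.trans hψ.source.2
  have hX := hasGKResolution_iff.1 (hasGKResolution_of_gkDim_eq (hφ.source.1.2.symm.trans hXn))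
  have hM := hasGKResolution_iff.1 (hasGKResolution_of_gkDim_eq (hM.2.symm.trans hMn))
  have hU := HasRes.kernel hK (shortExact_kernel φ hφ.surjective) hX hM
  have := hφ.source.1.1
  obtain ⟨rs, C, rfl, hrs, hC⟩ := hK.exists_regQuot (X := X) (n := n) fun i hi =>
    subsingleton_ext_of_lt_grade (by rw [hXn]; exact_mod_cast hi)
  have hE := hU.ext hK.finite fun i hi => hC.subsingleton_ext
    (fun r hr => annihilator_le_kernelObj φ (hrs r hr)) i hi
  obtain ⟨e⟩ := linkModule_iso (K := K) φ hφ.surjective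
    (hM.subsingleton_ext (fun h => h.ext_eq_zero) _ (Nat.lt_succ_self _))
  exact isGKPerfect_of_hasRes hK hNn (hE.of_iso IsTotallyReflexive.of_iso (e.symm ≪≫ α.symm))

end Linkage


/-! ### Finite projective dimension -/

section ProjectiveDimension

variable {R : Type u} [CommRing R]

/-- Finitely generated projective modules. -/
def fgProj (R : Type u) [CommRing R] : ObjectProperty (ModuleCat.{u} R) := fun P =>
  Module.Finite R P ∧ Module.Projective R P

theorem subsingleton_ext_of_projective {P : ModuleCat.{u} R} (hP : Module.Projective R P)
    (A : ModuleCat.{u} R) (i : ℕ) (hi : 0 < i) : Subsingleton (Ext P A i) := by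
  obtain ⟨i, rfl⟩ := Nat.exists_eq_succ_of_ne_zero hi.ne'
  have : Projective P := (IsProjective.iff_projective P).1 hP
  exact Ext.subsingleton_of_projective _ _ i

theorem hasProjectiveDimensionLT_one_iff {P : ModuleCat.{u} R} :
    HasProjectiveDimensionLT P 1 ↔ Module.Projective R P := by
  rw [← projective_iff_hasProjectiveDimensionLT_one, IsProjective.iff_projective]

theorem HasRes.of_hasProjectiveDimensionLE [IsNoetherianRing R] {n : ℕ} {M : ModuleCat.{u} R}
    [Module.Finite R M] (h : HasProjectiveDimensionLE M n) : HasRes (fgProj R) n M := by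
  induction n generalizing M with
  | zero => exact .zero ⟨inferInstance, hasProjectiveDimensionLT_one_iff.1 h⟩
  | succ n ih =>
    obtain ⟨r, a, ha⟩ := Module.Finite.exists_fin' R M
    let a' : ModuleCat.of R (Fin r → R) ⟶ M := ModuleCat.ofHom a
    have hS := shortExact_kernel a' ha
    have hF : fgProj R (ModuleCat.of R (Fin r → R)) :=
      ⟨inferInstanceAs (Module.Finite R (Fin r → R)),
        inferInstanceAs (Module.Projective R (Fin r → R))⟩
    have : Module.Finite R (kernelObj a') :=
      inferInstanceAs (Module.Finite R (LinearMap.ker a))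
    refine .succ_kernel a' ha hF (ih ?_)
    exact (hS.hasProjectiveDimensionLT_X₃_iff n ((IsProjective.iff_projective _).1 hF.2)).1 h

theorem HasRes.hasProjectiveDimensionLE {n : ℕ} {M : ModuleCat.{u} R}
    (h : HasRes (fgProj R) n M) : HasProjectiveDimensionLE M n := by
  induction h with
  | zero h => exact hasProjectiveDimensionLT_one_iff.2 h.2
  | @succ k S hS hG _ ih =>
    exact (hS.hasProjectiveDimensionLT_X₃_iff k ((IsProjective.iff_projective _).1 hG.2)).2 ih

theorem exists_retract_of_fgProj {G : ModuleCat.{u} R} (hG : fgProj R G) :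
    ∃ (n : ℕ) (i : G →ₗ[R] Fin n → R) (s : (Fin n → R) →ₗ[R] G), s ∘ₗ i = LinearMap.id := by
  obtain ⟨h₁, h₂⟩ := hG
  obtain ⟨n, s, hs⟩ := Module.Finite.exists_fin' R G
  obtain ⟨i, hi⟩ := Module.projective_lifting_property s LinearMap.id hs
  exact ⟨n, i, s, hi⟩

theorem projective_linearMap {G K : ModuleCat.{u} R} (hG : fgProj R G)
    (hK : Module.Projective R K) : Module.Projective R (G →ₗ[R] K) := by
  obtain ⟨n, i, s, hs⟩ := exists_retract_of_fgProj hG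
  have : Module.Projective R (Fin n → K) :=
    Module.Projective.of_equiv (DirectSum.linearEquivFunOnFintype R (Fin n) (fun _ => K))
  have : Module.Projective R ((Fin n → R) →ₗ[R] K) :=
    Module.Projective.of_equiv ((LinearMap.lsum R (fun _ : Fin n => R) R).symm ≪≫ₗ
      LinearEquiv.piCongrRight (fun _ => LinearMap.ringLmapEquivSelf R R K)).symm
  refine Module.Projective.of_split (LinearMap.lcomp R K s) (LinearMap.lcomp R K i) ?_
  ext f x
  exact congrArg f (LinearMap.congr_fun hs x)

theorem projective_ext_zero {G K : ModuleCat.{u} R} (hG : fgProj R G)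
    (hK : Module.Projective R K) : Module.Projective R (Ext G K 0) := by
  have := projective_linearMap hG hK
  exact Module.Projective.of_equiv (extZeroEquiv G K).symm

/-- If `Ext^i(M, K) = 0` for `i < n`, `M` has projective dimension at most `n` and `K` is
projective, then `Ext^n(M, K)` has projective dimension at most `n`. -/
theorem HasRes.hasProjectiveDimensionLE_ext {K : ModuleCat.{u} R} (hK : Module.Projective R K)
    {n : ℕ} {M : ModuleCat.{u} R} (h : HasRes (fgProj R) n M)
    (hM : ∀ i < n, Subsingleton (Ext M K i)) :
    HasProjectiveDimensionLE (ModuleCat.of R (Ext M K n)) n := by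
  have H : IsCosyzygyStable (fgProj R) (𝟙 K)
      (fun j U _ _ => HasProjectiveDimensionLT U j) :=
    { acyclic_left := fun hG => subsingleton_ext_of_projective hG.2 K
      acyclic_right := fun hG => subsingleton_ext_of_projective hG.2 K
      zero := fun {U} _ _ h _ => (ModuleCat.isZero_of_subsingleton U).hasProjectiveDimensionLT_zero
      iso := fun {j} _ _ _ _ _ _ e _ _ h => hasProjectiveDimensionLT_of_iso e j
      step := fun {j} {G} hG {U V U' V'} g g' i p w hS i' p' w' hS' hi hp h => by
        have := (hasProjectiveDimensionLT_one_iff (P := ModuleCat.of R (Ext G K 0))).2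
          (projective_ext_zero hG hK)
        exact hS.hasProjectiveDimensionLT_X₃ j h
          (hasProjectiveDimensionLT_of_ge _ 1 (j + 1) (by omega)) }
  exact H.ext h hM hM

theorem exists_free_cover (L : ModuleCat.{u} R) [Module.Finite R L] :
    ∃ (s : ℕ) (a : ModuleCat.of R (Fin s → R) ⟶ L), Function.Surjective a := by
  obtain ⟨s, a, ha⟩ := Module.Finite.exists_fin' R L
  exact ⟨s, ModuleCat.ofHom a, ha⟩

theorem subsingleton_ext_fin {Z A : ModuleCat.{u} R} {i : ℕ} (h : Subsingleton (Ext Z A i))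
    (s : ℕ) : Subsingleton (Ext Z (ModuleCat.of R (Fin s → A)) i) := by
  induction s with
  | zero =>
    refine subsingleton_of_forall_eq 0 fun x => ?_
    have : 𝟙 (ModuleCat.of R (Fin 0 → A)) = 0 :=
      ModuleCat.hom_ext (LinearMap.ext fun x => funext fun j => j.elim0)
    rw [← x.comp_mk₀_id, this, Ext.mk₀_zero, Ext.comp_zero]
  | succ s ih =>
    have h₂ : Subsingleton (Ext Z (ModuleCat.of R (A × (Fin s → A))) i) := by
      refine subsingleton_of_forall_eq 0 fun x => ?_
      obtain ⟨y, hy⟩ := Ext.covariant_sequence_exact₂ Z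
        (shortExact_prod A (ModuleCat.of R (Fin s → A))) x (Subsingleton.elim _ _)
      rw [← hy, Subsingleton.elim (α := Ext Z A i) y 0]
      exact Ext.zero_comp ..
    exact (extCongrRight Z (Fin.consLinearEquiv R (fun _ : Fin (s + 1) => (A : Type u))).toModuleIso
      i).symm.injective.subsingleton

variable [IsNoetherianRing R]

theorem hasProjectiveDimensionLT_of_subsingleton_ext {Z : ModuleCat.{u} R} [Module.Finite R Z]
    {p : ℕ} (hp : HasProjectiveDimensionLT Z (p + 1))
    (h : Subsingleton (Ext Z (ModuleCat.of R R) p)) : HasProjectiveDimensionLT Z p := by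
  refine ModuleCat.hasProjectiveDimensionLT_of_forall_finite Z p fun L hL => ?_
  obtain ⟨s, a, ha⟩ := exists_free_cover L
  have := subsingleton_ext_fin h s
  exact subsingleton_ext_co₃ (shortExact_kernel a ha) Z p this
    (HasProjectiveDimensionLT.subsingleton Z (p + 1) _ le_rfl _)

theorem subsingleton_of_hasProjectiveDimensionLT {Z : ModuleCat.{u} R} [Module.Finite R Z]
    {p : ℕ} (hp : HasProjectiveDimensionLT Z p)
    (h : ∀ i < p, Subsingleton (Ext Z (ModuleCat.of R R) i)) : Subsingleton Z := by
  induction p with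
  | zero => exact ModuleCat.subsingleton_of_isZero (isZero_of_hasProjectiveDimensionLT_zero Z)
  | succ p ih =>
    exact ih (hasProjectiveDimensionLT_of_subsingleton_ext hp (h p p.lt_succ_self))
      fun i hi => h i (by omega)

end ProjectiveDimension

/-! ### Local rings -/

section Local

variable {R : Type u} [CommRing R] [IsLocalRing R]

open IsLocalRing

/-- The residue field as an object of the category of modules. -/
abbrev residueObj (R : Type u) [CommRing R] [IsLocalRing R] : ModuleCat.{u} R :=
  ModuleCat.of R (ResidueField R)

theorem smul_residueObj {r : R} (hr : r ∈ maximalIdeal R) (x : residueObj R) : r • x = 0 := by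
  have : (algebraMap R (ResidueField R)) r = 0 := (residue_eq_zero_iff r).2 hr
  exact (Algebra.smul_def r (x : ResidueField R)).trans (by rw [this, zero_mul])

theorem map_residueObj_eq_zero {B : Type u} [AddCommGroup B] [Module R B]
    (t : B →ₗ[R] residueObj R) {b : B} (hb : b ∈ maximalIdeal R • (⊤ : Submodule R B)) :
    t b = 0 := by
  refine Submodule.smul_induction_on hb (fun r hr x _ => ?_) (fun x y hx hy => ?_)
  · rw [map_smul, smul_residueObj hr]
  · rw [map_add, hx, hy, add_zero]

theorem exists_minimal_cover (M : ModuleCat.{u} R) [Module.Finite R M] :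
    ∃ (s : ℕ) (a : ModuleCat.of R (Fin s → R) ⟶ M), Function.Surjective a ∧
      ∀ x, a x = 0 → x ∈ maximalIdeal R • (⊤ : Submodule R (Fin s → R)) := by
  classical
  have hex := exists_free_cover M
  obtain ⟨a, ha⟩ := Nat.find_spec hex
  refine ⟨Nat.find hex, a, ha, fun x hx => ?_⟩
  have hmin := fun m => Nat.find_min hex (m := m)
  generalize Nat.find hex = s at *
  have key : ∀ i, x i ∈ maximalIdeal R := by
    intro i
    by_contra hi
    rw [mem_maximalIdeal, mem_nonunits_iff, not_not] at hi
    obtain ⟨v, hv⟩ := hi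
    obtain _ | s := s
    · exact i.elim0
    let E : (Fin s → R) →ₗ[R] Fin (s + 1) → R :=
      LinearMap.pi fun j => i.succAboveCases 0 (fun k => LinearMap.proj k) j
    refine hmin s s.lt_succ_self ⟨ModuleCat.ofHom (a.hom.comp E), fun y => ?_⟩
    obtain ⟨z, rfl⟩ := ha y
    refine ⟨fun k => (z - (z i * (v⁻¹ : Rˣ)) • x) (i.succAbove k), ?_⟩
    have hE : E (fun k => (z - (z i * (v⁻¹ : Rˣ)) • x) (i.succAbove k)) =
        z - (z i * (v⁻¹ : Rˣ)) • x := by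
      funext j
      obtain rfl | ⟨k, rfl⟩ := i.eq_self_or_eq_succAbove j
      · simp [E, ← hv]
      · simp [E]
    change a (E _) = a z
    rw [hE, map_sub, map_smul, hx, smul_zero, sub_zero]
  rw [← Finset.univ_sum_single x]
  refine Submodule.sum_mem _ fun i _ => ?_
  have : Pi.single i (x i) = x i • (Pi.single i 1 : Fin s → R) := by
    rw [← Pi.single_smul, smul_eq_mul, mul_one]
  rw [this]
  exact Submodule.smul_mem_smul (key i) trivial

end Local


/-! ### Freeness over local rings -/

section Local

variable {R : Type u} [CommRing R] [IsLocalRing R]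

open IsLocalRing

theorem comp_ofHom_eq_zero {A B : ModuleCat.{u} R} (f : A ⟶ B)
    (hf : ∀ a, f a ∈ maximalIdeal R • (⊤ : Submodule R B)) (t : Ext B (residueObj R) 0) :
    (Ext.mk₀ f).comp t (zero_add 0) = 0 := by
  rw [← mk₀_ofHom_extZeroEquiv t, Ext.mk₀_comp_mk₀, ← Ext.mk₀_zero]
  congr 1
  ext a
  exact map_residueObj_eq_zero (extZeroEquiv B _ t) (hf a)

theorem extPost_mem_maximalIdeal_smul {G : ModuleCat.{u} R} (hG : fgProj R G)
    {A B : ModuleCat.{u} R} (f : A ⟶ B)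
    (hf : ∀ a, f a ∈ maximalIdeal R • (⊤ : Submodule R B)) (x : Ext G A 0) :
    extPost G f 0 x ∈ maximalIdeal R • (⊤ : Submodule R (Ext G B 0)) := by
  obtain ⟨n, i, s, hs⟩ := exists_retract_of_fgProj hG
  have key : ∀ (b : B), b ∈ maximalIdeal R • (⊤ : Submodule R B) → ∀ j : Fin n,
      (LinearMap.proj j ∘ₗ i).smulRight b ∈ maximalIdeal R • (⊤ : Submodule R (G →ₗ[R] B)) := by
    intro b hb j
    exact Submodule.smul_top_le_comap_smul_top (maximalIdeal R)
      (LinearMap.smulRightₗ (LinearMap.proj j ∘ₗ i)) hb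
  have h : extZeroEquiv G B (extPost G f 0 x) ∈
      maximalIdeal R • (⊤ : Submodule R (G →ₗ[R] B)) := by
    have : extZeroEquiv G B (extPost G f 0 x) = ∑ j, (LinearMap.proj j ∘ₗ i).smulRight
        (f (extZeroEquiv G A x (s (Pi.single j 1)))) := by
      rw [← mk₀_ofHom_extZeroEquiv x]
      change extZeroEquiv G B ((Ext.mk₀ _).comp (Ext.mk₀ f) (add_zero 0)) = _
      rw [Ext.mk₀_comp_mk₀, extZeroEquiv_mk₀, extZeroEquiv_mk₀]
      ext g
      change f (extZeroEquiv G A x g) = _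
      rw [LinearMap.sum_apply]
      simp only [LinearMap.smulRight_apply, LinearMap.comp_apply, LinearMap.proj_apply]
      have hg : g = ∑ j, i g j • s (Pi.single j 1) := by
        have : i g = ∑ j, i g j • (Pi.single j 1 : Fin n → R) := by
          ext k
          simp [Finset.sum_apply, Pi.single_apply]
        calc g = s (i g) := (LinearMap.congr_fun hs g).symm
          _ = _ := (congrArg s this).trans (by simp only [map_sum, map_smul])
      conv_lhs => rw [hg]
      simp only [map_sum, map_smul]
      rfl
    rw [this]
    exact Submodule.sum_mem _ fun j _ => key _ (hf _) j
  have := Submodule.smul_top_le_comap_smul_top (maximalIdeal R)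
    (extZeroEquiv G B).symm.toLinearMap h
  simpa using this

/-- If `f : A → B` has image in `𝔪 B` and `B` is projective, then
`Ext^n(Ext^n(X, f), k) = 0`. -/
theorem ext_extPost_comp_eq_zero {A B : ModuleCat.{u} R} (f : A ⟶ B)
    (hf : ∀ a, f a ∈ maximalIdeal R • (⊤ : Submodule R B))
    (hB : Module.Projective R B) {n : ℕ} {X : ModuleCat.{u} R} (hX : HasRes (fgProj R) n X)
    (hXA : ∀ i < n, Subsingleton (Ext X A i)) (hXB : ∀ i < n, Subsingleton (Ext X B i))
    (ξ : Ext (ModuleCat.of R (Ext X B n)) (residueObj R) n) :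
    (Ext.mk₀ (extPost X f n)).comp ξ (zero_add n) = 0 := by
  have H : IsCosyzygyStable (fgProj R) f (fun j _ V g =>
      Nat.casesOn j (Subsingleton V) fun j =>
        ∀ ξ : Ext V (residueObj R) j, (Ext.mk₀ g).comp ξ (zero_add j) = 0) :=
    { acyclic_left := fun hG => subsingleton_ext_of_projective hG.2 A
      acyclic_right := fun hG => subsingleton_ext_of_projective hG.2 B
      zero := fun {U V} _ _ h => h
      iso := fun {j} U V U' V' g g' e e' w h => by
        cases j with
        | zero =>
          exact @Equiv.subsingleton _ _ e'.toLinearEquiv.symm.toEquiv h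
        | succ j =>
          intro ξ
          have hg : g' = e.inv ≫ g ≫ e'.hom := by rw [← w, e.inv_hom_id_assoc]
          have := h ((Ext.mk₀ e'.hom).comp ξ (zero_add j))
          rw [hg, ← Ext.mk₀_comp_mk₀_assoc, ← Ext.mk₀_comp_mk₀_assoc, this, Ext.comp_zero]
      step := fun {j} {G} hG {U V U' V'} g g' i p w hS i' p' w' hS' hi hp h => by
        cases j with
        | zero =>
          intro ξ
          have := hS.epi_g
          apply Ext.precomp_mk₀_injective_of_epi _ p
          change (Ext.mk₀ p).comp _ (zero_add 0) = (Ext.mk₀ p).comp _ (zero_add 0)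
          rw [Ext.comp_zero, Ext.mk₀_comp_mk₀_assoc, hp, ← Ext.mk₀_comp_mk₀_assoc]
          exact comp_ofHom_eq_zero _ (extPost_mem_maximalIdeal_smul hG f hf) _
        | succ j =>
          intro ξ
          obtain ⟨η, rfl⟩ := extDelta_surjective hS' (residueObj R) j
            (subsingleton_ext_of_projective (projective_ext_zero hG hB) _ _ (by omega)) ξ
          let F : ShortComplex.mk i p w ⟶ ShortComplex.mk i' p' w' :=
            { τ₁ := g, τ₂ := extPost G f 0, τ₃ := g', comm₁₂ := hi.symm, comm₂₃ := hp.symm }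
          have hF := hS.extClass_naturality hS' F
          calc (Ext.mk₀ g').comp (hS'.extClass.comp η (add_comm 1 j)) (zero_add (j + 1))
              = ((Ext.mk₀ g').comp hS'.extClass (zero_add 1)).comp η (add_comm 1 j) :=
                (Ext.comp_assoc _ _ _ (zero_add 1) (add_comm 1 j) (by omega)).symm
            _ = (hS.extClass.comp (Ext.mk₀ g) (add_zero 1)).comp η (add_comm 1 j) :=
                congrArg (fun z => z.comp η (add_comm 1 j)) hF.symm
            _ = hS.extClass.comp ((Ext.mk₀ g).comp η (zero_add j)) (add_comm 1 j) :=
                Ext.comp_assoc _ _ _ (add_zero 1) (zero_add j) (by omega)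
            _ = 0 := (congrArg (fun z => hS.extClass.comp z (add_comm 1 j)) (h η)).trans
                (Ext.comp_zero ..) }
  exact H.ext hX hXA hXB ξ

variable [IsNoetherianRing R]

theorem subsingleton_of_subsingleton_ext_residueObj {Z : ModuleCat.{u} R} [Module.Finite R Z]
    (h : Subsingleton (Ext Z (residueObj R) 0)) : Subsingleton Z := by
  have h₁ : Subsingleton (Z →ₗ[R] residueObj R) := (extZeroEquiv Z _).symm.injective.subsingleton
  have : Module.Finite R (residueObj R) := inferInstanceAs (Module.Finite R (ResidueField R))
  obtain ⟨r, hr, hreg⟩ := IsSMulRegular.subsingleton_linearMap_iff.1 h₁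
  have hu : IsUnit r := by
    by_contra hr'
    have : (1 : ResidueField R) = 0 := hreg
      ((smul_residueObj ((mem_maximalIdeal r).2 hr') (1 : ResidueField R)).trans
        (smul_zero r).symm)
    exact one_ne_zero this
  refine subsingleton_of_forall_eq 0 fun z => ?_
  exact (hu.smul_eq_zero).1 (Module.mem_annihilator.1 hr z)

theorem hasProjectiveDimensionLT_of_subsingleton_ext_residueObj {n : ℕ} {Z : ModuleCat.{u} R}
    [Module.Finite R Z] (hZ : HasProjectiveDimensionLT Z (n + 1))
    (h : Subsingleton (Ext Z (residueObj R) n)) : HasProjectiveDimensionLT Z n := by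
  induction n generalizing Z with
  | zero =>
    have := subsingleton_of_subsingleton_ext_residueObj h
    exact (ModuleCat.isZero_of_subsingleton Z).hasProjectiveDimensionLT_zero
  | succ n ih =>
    obtain ⟨s, a, ha, hmin⟩ := exists_minimal_cover Z
    have hS := shortExact_kernel a ha
    have hF : Module.Projective R (ModuleCat.of R (Fin s → R)) :=
      inferInstanceAs (Module.Projective R (Fin s → R))
    have hF' := hasProjectiveDimensionLT_one_iff.2 hF
    have : Module.Finite R (kernelObj a) := inferInstanceAs (Module.Finite R (LinearMap.ker a.hom))
    refine hS.hasProjectiveDimensionLT_X₃ n (ih ?_ ?_)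
      (hasProjectiveDimensionLT_of_ge _ 1 (n + 1) (by omega))
    · exact (hS.hasProjectiveDimensionLT_X₃_iff n ((IsProjective.iff_projective _).1 hF)).1 hZ
    · refine subsingleton_of_forall_eq 0 fun x => ?_
      obtain ⟨y, rfl⟩ := extPre_f_surjective hS (residueObj R) n h x
      cases n with
      | zero => exact comp_ofHom_eq_zero (kerIncl a) (fun b => hmin _ b.2) y
      | succ n =>
        have := subsingleton_ext_of_projective hF (residueObj R) (n + 1) n.succ_pos
        rw [Subsingleton.elim (α := Ext (ModuleCat.of R (Fin s → R)) _ _) y 0]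
        exact map_zero _

theorem exists_surjective_residueObj {Z : ModuleCat.{u} R} [Module.Finite R Z] [Nontrivial Z] :
    ∃ f : Z ⟶ residueObj R, Function.Surjective f := by
  by_contra! hf
  refine not_subsingleton Z (subsingleton_of_subsingleton_ext_residueObj
    (subsingleton_of_forall_eq 0 fun x => ?_))
  apply (extZeroEquiv Z (residueObj R)).injective
  rw [map_zero]
  by_contra hne
  obtain ⟨z, hz⟩ := DFunLike.ne_iff.1 hne
  refine hf (ModuleCat.ofHom (extZeroEquiv Z (residueObj R) x)) fun y => ?_
  obtain ⟨r, hr⟩ := residue_surjective (show ResidueField R from y * (extZeroEquiv Z _ x z)⁻¹)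
  refine ⟨r • z, ?_⟩
  change extZeroEquiv Z _ x (r • z) = y
  rw [map_smul]
  refine (Algebra.smul_def r (show ResidueField R from extZeroEquiv Z _ x z)).trans ?_
  exact (congrArg (· * _) hr).trans (inv_mul_cancel_right₀ hz _)

/-- Let `X ≠ 0` be annihilated by an `R`-regular sequence of length `n ≥ pd X`. If
`Ext^i(X, K) = 0` for `i < n` and `Ext^n(X, K)` has projective dimension at most `n`, then `K` is
free. -/
theorem free_of_hasProjectiveDimensionLE_ext {K X C : ModuleCat.{u} R} [Module.Finite R K]
    [Nontrivial X] {rs : List R} (hX : HasRes (fgProj R) rs.length X)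
    (hrs : RegQuot rs (ModuleCat.of R R) C) (hann : ∀ r ∈ rs, r ∈ Module.annihilator R X)
    (hXK : ∀ i < rs.length, Subsingleton (Ext X K i))
    (hY : HasProjectiveDimensionLE (ModuleCat.of R (Ext X K rs.length)) rs.length) :
    ∃ s : ℕ, Nonempty (ModuleCat.of R (Fin s → R) ≅ K) := by
  have := hX.finite fun h => h.1
  obtain ⟨s, a, ha, hmin⟩ := exists_minimal_cover K
  have hS := shortExact_kernel a ha
  have hF : Module.Projective R (ModuleCat.of R (Fin s → R)) :=
    inferInstanceAs (Module.Projective R (Fin s → R))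
  have : Module.Finite R (kernelObj a) := inferInstanceAs (Module.Finite R (LinearMap.ker a.hom))
  have hXR := hrs.subsingleton_ext hann
  have hXF (i : ℕ) (hi : i < rs.length) := subsingleton_ext_fin (hXR i hi) s
  have hXK₁ : ∀ i < rs.length, Subsingleton (Ext X (kernelObj a) i) := by
    rintro (_ | i) hi
    · exact subsingleton_ext_co₁_zero hS X (hXF 0 hi)
    · exact subsingleton_ext_co₁ hS X i (hXK i (by omega)) (hXF _ hi)
  have htop (A : ModuleCat.{u} R) : Subsingleton (Ext X A (rs.length + 1)) :=
    hX.subsingleton_ext (fun h => subsingleton_ext_of_projective h.2 A) _ (Nat.lt_succ_self _)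
  have hinj : Function.Injective (extPost X (kerIncl a) rs.length) := by
    generalize rs.length = n at *
    cases n with
    | zero => exact extPost_injective_zero hS X
    | succ n => exact extPost_injective hS X n (hXK n n.lt_succ_self)
  have hT := shortExact_of_exact _ _
    (by ext x; exact (extPost_exact hS X rs.length).apply_apply_eq_zero x) hinj
    (extPost_exact hS X rs.length) (extPost_surjective hS X rs.length (htop _))
  have hY₂ := hX.hasProjectiveDimensionLE_ext hF hXF
  have hY₁ : HasProjectiveDimensionLT (ModuleCat.of R (Ext X (kernelObj a) rs.length))
      (rs.length + 1) :=
    hT.hasProjectiveDimensionLT_X₁ (rs.length + 1) hY₂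
      (hasProjectiveDimensionLT_of_ge _ (rs.length + 1) (rs.length + 2) (by omega))
  have hExt : Subsingleton
      (Ext (ModuleCat.of R (Ext X (kernelObj a) rs.length)) (residueObj R) rs.length) := by
    refine subsingleton_of_forall_eq 0 fun x => ?_
    obtain ⟨y, rfl⟩ := extPre_f_surjective hT (residueObj R) rs.length
      (HasProjectiveDimensionLT.subsingleton _ (rs.length + 1) _ le_rfl _) x
    exact ext_extPost_comp_eq_zero (kerIncl a) (fun b => hmin _ b.2) hF hX hXK₁ hXF y
  have hY₁' : Subsingleton (Ext X (kernelObj a) rs.length) :=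
    subsingleton_of_hasProjectiveDimensionLT
      (Z := ModuleCat.of R (Ext X (kernelObj a) rs.length))
      (hasProjectiveDimensionLT_of_subsingleton_ext_residueObj hY₁ hExt)
      (hrs.subsingleton_ext fun r hr => Module.mem_annihilator.2 fun y =>
        smul_ext_eq_zero (hann r hr) y)
  have hK₁ : Subsingleton (kernelObj a) := by
    by_contra hne
    rw [not_subsingleton_iff_nontrivial] at hne
    obtain ⟨f, hf⟩ := exists_surjective_residueObj (Z := kernelObj a)
    refine not_subsingleton X (subsingleton_of_hasProjectiveDimensionLT
      (hasProjectiveDimensionLT_of_subsingleton_ext_residueObj hX.hasProjectiveDimensionLE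
        (subsingleton_ext_co₃ (shortExact_kernel f hf) X _ hY₁' (htop _))) hXR)
  have hinj : Function.Injective a.hom :=
    LinearMap.ker_eq_bot.1 ((LinearMap.ker a.hom).subsingleton_iff_eq_bot.1 hK₁)
  exact ⟨s, ⟨(LinearEquiv.ofBijective a.hom ⟨hinj, ha⟩).toModuleIso⟩⟩

end Local


/-! ### Change of rings -/

section ChangeOfRings

variable {R : Type u} [CommRing R]

section BaseChange

variable (S : Type u) [CommRing S] [Algebra R S]

/-- The base change `S ⊗_R M`. -/
abbrev baseChangeObj (M : ModuleCat.{u} R) : ModuleCat.{u} S :=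
  ModuleCat.of S (S ⊗[R] M)

/-- The base change of a map. -/
abbrev baseChangeMap {M N : ModuleCat.{u} R} (f : M ⟶ N) :
    baseChangeObj S M ⟶ baseChangeObj S N :=
  ModuleCat.ofHom (f.hom.baseChange S)

theorem baseChangeMap_surjective {M N : ModuleCat.{u} R} (f : M ⟶ N)
    (hf : Function.Surjective f) : Function.Surjective (baseChangeMap S f) :=
  LinearMap.lTensor_surjective S (g := f.hom) hf

/-- Base change of an isomorphism. -/
def baseChangeIso {M N : ModuleCat.{u} R} (e : M ≅ N) : baseChangeObj S M ≅ baseChangeObj S N :=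
  (LinearEquiv.baseChange R S M N e.toLinearEquiv).toModuleIso

theorem shortExact_baseChange [Module.Flat R S] {T : ShortComplex (ModuleCat.{u} R)}
    (hT : T.ShortExact) :
    (ShortComplex.mk (baseChangeMap S T.f) (baseChangeMap S T.g) (by
      rw [← ModuleCat.ofHom_comp, ← LinearMap.baseChange_comp, ← ModuleCat.hom_comp, T.zero,
        ModuleCat.hom_zero, LinearMap.baseChange_zero, ModuleCat.ofHom_zero])).ShortExact :=
  shortExact_of_exact _ _ _
    (Module.Flat.lTensor_preserves_injective_linearMap (M := S) T.f.hom
      ((ModuleCat.mono_iff_injective _).1 hT.mono_f))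
    (lTensor_exact S ((ShortComplex.ShortExact.moduleCat_exact_iff_function_exact _).1 hT.exact)
      ((ModuleCat.epi_iff_surjective _).1 hT.epi_g))
    (baseChangeMap_surjective S _ ((ModuleCat.epi_iff_surjective _).1 hT.epi_g))

theorem HasRes.baseChange [Module.Flat R S] {n : ℕ} {M : ModuleCat.{u} R}
    (h : HasRes (fgProj R) n M) : HasRes (fgProj S) n (baseChangeObj S M) := by
  induction h with
  | @zero M hM =>
    obtain ⟨_, _⟩ := hM
    exact .zero ⟨inferInstanceAs (Module.Finite S (S ⊗[R] M)),
      inferInstanceAs (Module.Projective S (S ⊗[R] M))⟩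
  | @succ k T hT hG h ih =>
    obtain ⟨_, _⟩ := hG
    exact .succ (shortExact_baseChange S hT) ⟨inferInstanceAs (Module.Finite S (S ⊗[R] T.X₂)),
      inferInstanceAs (Module.Projective S (S ⊗[R] T.X₂))⟩ ih

theorem algebraMap_mem_annihilator_baseChange {M : ModuleCat.{u} R} {r : R}
    (hr : r ∈ Module.annihilator R M) :
    algebraMap R S r ∈ Module.annihilator S (baseChangeObj S M) := by
  refine Module.mem_annihilator.2 fun z => ?_
  change algebraMap R S r • (show S ⊗[R] M from z) = 0
  rw [algebraMap_smul]
  induction (show S ⊗[R] M from z) with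
  | zero => exact smul_zero r
  | tmul s m => rw [← TensorProduct.tmul_smul, Module.mem_annihilator.1 hr, TensorProduct.tmul_zero]
  | add x y hx hy => rw [smul_add, hx, hy, add_zero]

theorem RegQuot.baseChange [Module.Flat R S] {rs : List R} {A B : ModuleCat.{u} R}
    (h : RegQuot rs A B) :
    RegQuot (rs.map (algebraMap R S)) (baseChangeObj S A) (baseChangeObj S B) := by
  induction h with
  | nil e => exact .nil (baseChangeIso S e)
  | @cons x rs A B C hx p hp hk h ih =>
    have hS := shortExact_baseChange S (shortExact_smul hx p hp hk)
    have hsmul (a : S ⊗[R] A) :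
        baseChangeMap S (x • 𝟙 A) a = algebraMap R S x • a := by
      change (LinearMap.baseChange S (x • 𝟙 A : A ⟶ A).hom) a = _
      rw [ModuleCat.hom_smul, LinearMap.baseChange_smul, ModuleCat.hom_id, LinearMap.baseChange_id,
        algebraMap_smul]
      rfl
    have hinj : Function.Injective (baseChangeMap S (x • 𝟙 A)) :=
      (ModuleCat.mono_iff_injective _).1 hS.mono_f
    have hex : Function.Exact (baseChangeMap S (x • 𝟙 A)) (baseChangeMap S p) :=
      (ShortComplex.ShortExact.moduleCat_exact_iff_function_exact _).1 hS.exact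
    refine .cons (fun a b hab => hinj ((hsmul a).trans (Eq.trans hab (hsmul b).symm)))
      (baseChangeMap S p) (baseChangeMap_surjective S p hp) (fun a => ⟨fun h => ?_, ?_⟩) ih
    · obtain ⟨b, hb⟩ := (hex a).1 h
      exact ⟨b, (hsmul b).symm.trans hb⟩
    · rintro ⟨b, hb⟩
      exact (hex a).2 ⟨b, (hsmul b).trans hb⟩

end BaseChange

section RegularQuotient

theorem RegQuot.of_iso_left {rs : List R} {A A' B : ModuleCat.{u} R} (e : A' ≅ A)
    (h : RegQuot rs A B) : RegQuot rs A' B := by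
  cases h with
  | nil e' => exact .nil (e ≪≫ e')
  | @cons x rs _ _ C hx p hp hk h =>
    have he : Function.Bijective e.hom := e.toLinearEquiv.bijective
    have hsmul (a : A') : e.hom (x • a) = x • e.hom a := e.toLinearEquiv.map_smul x a
    refine .cons (fun a b hab => he.1 (hx ?_)) (e.hom ≫ p) (hp.comp he.2) (fun a => ?_) h
    · exact (hsmul a).symm.trans ((congrArg e.hom hab).trans (hsmul b))
    · refine (hk (e.hom a)).trans ⟨?_, ?_⟩
      · rintro ⟨b, hb⟩
        obtain ⟨b, rfl⟩ := he.2 b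
        exact ⟨b, he.1 ((hsmul b).trans hb)⟩
      · rintro ⟨b, rfl⟩
        exact ⟨e.hom b, (hsmul b).symm⟩

theorem RegQuot.of_iso_right {rs : List R} {A B B' : ModuleCat.{u} R} (h : RegQuot rs A B)
    (e : B ≅ B') : RegQuot rs A B' := by
  induction h with
  | nil e' => exact .nil (e' ≪≫ e)
  | cons hx p hp hk _ ih => exact .cons hx p hp hk (ih e)

theorem RegQuot.append {rs ss : List R} {A B C : ModuleCat.{u} R} (h : RegQuot rs A B)
    (h' : RegQuot ss B C) : RegQuot (rs ++ ss) A C := by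
  induction h with
  | nil e => exact h'.of_iso_left e
  | cons hx p hp hk _ ih => exact .cons hx p hp hk (ih h')

theorem RegQuot.pi {rs : List R} {A B : ModuleCat.{u} R} (h : RegQuot rs A B) (q : ℕ) :
    RegQuot rs (ModuleCat.of R (Fin q → A)) (ModuleCat.of R (Fin q → B)) := by
  induction h with
  | nil e => exact .nil (LinearEquiv.piCongrRight fun _ : Fin q => e.toLinearEquiv).toModuleIso
  | @cons x rs A B C hx p hp hk _ ih =>
    refine .cons (A := ModuleCat.of R (Fin q → A)) (C := ModuleCat.of R (Fin q → C))
      (fun a b hab => funext fun j => hx (congrFun hab j))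
      (ModuleCat.ofHom (LinearMap.pi fun j => p.hom ∘ₗ LinearMap.proj j)) (fun y => ?_)
      (fun a => ?_) ih
    · choose z hz using fun j => hp (y j)
      exact ⟨z, funext hz⟩
    · refine funext_iff.trans ((forall_congr' fun j => hk (a j)).trans ⟨fun h => ?_, ?_⟩)
      · choose b hb using h
        exact ⟨b, funext hb⟩
      · rintro ⟨b, rfl⟩ j
        exact ⟨b j, rfl⟩

theorem RegQuot.hasProjectiveDimensionLE {rs : List R} {A B : ModuleCat.{u} R}
    (h : RegQuot rs A B) {p : ℕ} (hA : HasProjectiveDimensionLE A p) :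
    HasProjectiveDimensionLE B (rs.length + p) := by
  induction h generalizing p with
  | nil e =>
    have := hasProjectiveDimensionLT_of_iso e (p + 1)
    exact hasProjectiveDimensionLT_of_ge _ (p + 1) _ (by simp)
  | @cons x rs A B C hx p' hp hk _ ih =>
    have hC : HasProjectiveDimensionLE C (p + 1) :=
      (shortExact_smul hx p' hp hk).hasProjectiveDimensionLT_X₃ (p + 1) hA
        (hasProjectiveDimensionLT_of_ge _ (p + 1) _ (by omega))
    have := ih hC
    rwa [show (x :: rs).length + p = rs.length + (p + 1) by rw [List.length_cons]; omega]

open scoped Pointwise in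
/-- A weakly regular sequence gives the iterated quotient. -/
theorem RegQuot.of_isWeaklyRegular {rs : List R} {A : ModuleCat.{u} R}
    (h : RingTheory.Sequence.IsWeaklyRegular A rs) :
    RegQuot rs A (ModuleCat.of R (A ⧸ (Ideal.ofList rs • ⊤ : Submodule R A))) := by
  induction rs generalizing A with
  | nil =>
    refine .nil (Submodule.quotEquivOfEqBot _ ?_).symm.toModuleIso
    rw [Ideal.ofList_nil, Submodule.bot_smul]
  | cons x rs ih =>
    rw [RingTheory.Sequence.isWeaklyRegular_cons_iff] at h
    have h' := ih (A := ModuleCat.of R (QuotSMulTop x A)) h.2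
    refine .cons h.1 (ModuleCat.ofHom (Submodule.mkQ (x • ⊤ : Submodule R A)))
      (Submodule.mkQ_surjective _) (fun a => ?_) (h'.of_iso_right
        (Submodule.quotOfListConsSMulTopEquivQuotSMulTopInner A x rs).symm.toModuleIso)
    refine (Submodule.Quotient.mk_eq_zero _).trans ?_
    rw [Submodule.mem_smul_pointwise_iff_exists]
    simp

end RegularQuotient

end ChangeOfRings


/-! ### Restriction of scalars along a surjection -/

section Restriction

variable {Q S : Type u} [CommRing Q] [CommRing S] (π : Q →+* S)

/-- Restriction of scalars. -/
abbrev restrictObj (V : ModuleCat.{u} S) : ModuleCat.{u} Q :=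
  (ModuleCat.restrictScalars.{u} π).obj V

/-- Restriction of scalars of an isomorphism. -/
def restrictIso {V W : ModuleCat.{u} S} (e : V ≅ W) : restrictObj π V ≅ restrictObj π W :=
  (ModuleCat.restrictScalars.{u} π).mapIso e

theorem shortExact_restrict {T : ShortComplex (ModuleCat.{u} S)} (hT : T.ShortExact) :
    (T.map (ModuleCat.restrictScalars.{u} π)).ShortExact :=
  shortExact_of_exact _ _ _ ((ModuleCat.mono_iff_injective T.f).1 hT.mono_f)
    ((ShortComplex.ShortExact.moduleCat_exact_iff_function_exact T).1 hT.exact)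
    ((ModuleCat.epi_iff_surjective T.g).1 hT.epi_g)

theorem mem_annihilator_restrict {V : ModuleCat.{u} S} {x : Q}
    (h : π x ∈ Module.annihilator S V) : x ∈ Module.annihilator Q (restrictObj π V) :=
  Module.mem_annihilator.2 fun v => Module.mem_annihilator.1 h v

theorem RegQuot.restrict {rs : List Q} {A B : ModuleCat.{u} S} (h : RegQuot (rs.map π) A B) :
    RegQuot rs (restrictObj π A) (restrictObj π B) := by
  induction rs generalizing A with
  | nil =>
    cases h with
    | nil e => exact .nil (restrictIso π e)
  | cons x rs ih =>
    cases h with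
    | @cons _ _ _ _ C hx p hp hk h =>
      exact .cons (C := restrictObj π C) hx ((ModuleCat.restrictScalars.{u} π).map p) hp hk (ih h)

/-- Over a surjection, linear maps over the two rings agree. -/
def restrictHomIso (hπ : Function.Surjective π) (V W : ModuleCat.{u} S) :
    ModuleCat.of Q (restrictObj π V →ₗ[Q] restrictObj π W) ≅
      restrictObj π (ModuleCat.of S (V →ₗ[S] W)) :=
  let e : (restrictObj π V →ₗ[Q] restrictObj π W) ≃ₗ[Q]
      restrictObj π (ModuleCat.of S (V →ₗ[S] W)) :=
    { toFun := fun f => (show V →ₗ[S] W from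
        { toFun := f
          map_add' := f.map_add
          map_smul' := fun s v => by
            obtain ⟨q, rfl⟩ := hπ s
            exact f.map_smul q v })
      invFun := fun g => ((ModuleCat.restrictScalars.{u} π).map
        (ModuleCat.ofHom (show V →ₗ[S] W from g))).hom
      map_add' := fun f g => rfl
      map_smul' := fun q f => rfl
      left_inv := fun f => rfl
      right_inv := fun g => rfl }
  e.toModuleIso

theorem finite_restrict (hπ : Function.Surjective π) (V : ModuleCat.{u} S)
    [hV : Module.Finite S V] : Module.Finite Q (restrictObj π V) := by
  let := π.toAlgebra
  have : Module.Finite Q S := Module.Finite.of_surjective (Algebra.linearMap Q S) hπ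
  have : IsScalarTower Q S (restrictObj π V) := ⟨fun q s v => mul_smul (π q) s (show V from v)⟩
  have : Module.Finite S (restrictObj π V) := hV
  exact Module.Finite.trans S _

theorem hasProjectiveDimensionLE_pi {V : ModuleCat.{u} Q} {c : ℕ}
    (h : HasProjectiveDimensionLE V c) (r : ℕ) :
    HasProjectiveDimensionLE (ModuleCat.of Q (Fin r → V)) c := by
  induction r with
  | zero =>
    have : Subsingleton (ModuleCat.of Q (Fin 0 → V)) := inferInstanceAs (Subsingleton (Fin 0 → V))
    have := (ModuleCat.isZero_of_subsingleton (ModuleCat.of Q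
      (Fin 0 → V))).hasProjectiveDimensionLT_zero
    exact hasProjectiveDimensionLT_of_ge _ 0 _ (by omega)
  | succ r ih =>
    have := (shortExact_prod V (ModuleCat.of Q (Fin r → V))).hasProjectiveDimensionLT_X₂ (c + 1)
      h ih
    exact hasProjectiveDimensionLT_of_iso (Fin.consLinearEquiv Q
      (fun _ : Fin (r + 1) => (V : Type u))).toModuleIso (c + 1)

/-- Restriction of scalars commutes with powers. -/
def restrictPiIso (V : ModuleCat.{u} S) (r : ℕ) :
    ModuleCat.of Q (Fin r → restrictObj π V) ≅ restrictObj π (ModuleCat.of S (Fin r → V)) :=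
  let e : (Fin r → restrictObj π V) ≃ₗ[Q] restrictObj π (ModuleCat.of S (Fin r → V)) :=
    { toFun := fun f => (show Fin r → V from f)
      invFun := fun f => f
      map_add' := fun _ _ => rfl
      map_smul' := fun _ _ => rfl
      left_inv := fun _ => rfl
      right_inv := fun _ => rfl }
  e.toModuleIso

theorem hasProjectiveDimensionLE_restrict_of_fgProj {c : ℕ}
    (h : HasProjectiveDimensionLE (restrictObj π (ModuleCat.of S S)) c) {V : ModuleCat.{u} S}
    (hV : fgProj S V) : HasProjectiveDimensionLE (restrictObj π V) c := by
  obtain ⟨r, i, s, his⟩ := exists_retract_of_fgProj hV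
  have ret : Retract V (ModuleCat.of S (Fin r → S)) :=
    { i := ModuleCat.ofHom i
      r := ModuleCat.ofHom s
      retract := by rw [← ModuleCat.ofHom_comp, his]; rfl }
  have := hasProjectiveDimensionLE_pi h r
  have := hasProjectiveDimensionLT_of_iso (restrictPiIso π (ModuleCat.of S S) r) (c + 1)
  exact (ret.map (ModuleCat.restrictScalars.{u} π)).hasProjectiveDimensionLT (c + 1)

theorem HasRes.hasProjectiveDimensionLE_restrict {c : ℕ}
    (h : HasProjectiveDimensionLE (restrictObj π (ModuleCat.of S S)) c) {n : ℕ}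
    {V : ModuleCat.{u} S} (hV : HasRes (fgProj S) n V) :
    HasProjectiveDimensionLE (restrictObj π V) (c + n) := by
  induction hV with
  | zero hV => exact hasProjectiveDimensionLE_restrict_of_fgProj π h hV
  | @succ k T hT hG _ ih =>
    have : HasProjectiveDimensionLT (T.map (ModuleCat.restrictScalars.{u} π)).X₂ (c + 1) :=
      hasProjectiveDimensionLE_restrict_of_fgProj π h hG
    exact (shortExact_restrict π hT).hasProjectiveDimensionLT_X₃ (c + k + 1) ih
      (hasProjectiveDimensionLT_of_ge _ (c + 1) _ (by omega))

end Restriction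

/-! ### Linkage and change of rings -/

section Linkage

variable {R : Type u} [CommRing R]

theorem RegQuot.exists_extension {rs : List R} {A B : ModuleCat.{u} R} (h : RegQuot rs A B)
    {T : ShortComplex (ModuleCat.{u} R)} (hT : T.ShortExact)
    (hann : ∀ r ∈ rs, r ∈ Module.annihilator R T.X₂)
    (hA : Subsingleton (Ext T.X₃ A (rs.length + 1))) (f : T.X₁ ⟶ B) :
    ∃ g : T.X₂ ⟶ B, T.f ≫ g = f := by
  obtain ⟨θ, hθ⟩ := h.exists_ext
  have hann₁ : ∀ r ∈ rs, r ∈ Module.annihilator R T.X₁ := fun r hr =>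
    LinearMap.annihilator_le_of_injective T.f.hom
      ((ModuleCat.mono_iff_injective _).1 hT.mono_f) (hann r hr)
  obtain ⟨y, hy⟩ := extPre_f_surjective hT A rs.length hA
    ((Ext.mk₀ f).comp θ (zero_add rs.length))
  obtain ⟨x, rfl⟩ := (hθ T.X₂ hann).2 y
  refine ⟨ModuleCat.ofHom (extZeroEquiv T.X₂ B x), ?_⟩
  have : (Ext.mk₀ T.f).comp x (zero_add 0) = Ext.mk₀ f := by
    apply (hθ T.X₁ hann₁).1
    refine (Ext.comp_assoc _ _ _ (zero_add 0) (zero_add _) (by omega)).trans hy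
  rw [← mk₀_ofHom_extZeroEquiv x, Ext.mk₀_comp_mk₀] at this
  exact Ext.homEquiv₀.symm.injective this

/-- `Hom(V, B) ≅ Ext^n(V, A)`. -/
theorem RegQuot.exists_linearEquiv {rs : List R} {A B : ModuleCat.{u} R} (h : RegQuot rs A B)
    {V : ModuleCat.{u} R} (hV : ∀ r ∈ rs, r ∈ Module.annihilator R V) :
    Nonempty ((V →ₗ[R] B) ≃ₗ[R] Ext V A rs.length) := by
  obtain ⟨θ, hθ⟩ := h.exists_ext
  exact ⟨(extZeroEquiv V B).symm ≪≫ₗ LinearEquiv.ofBijective _ (hθ V hV)⟩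

/-- The link, in terms of `Hom`. -/
theorem linkModule_iso_range {K B : ModuleCat.{u} R} {rs : List R} (h : RegQuot rs K B)
    {X M : ModuleCat.{u} R} (φ : X ⟶ M) (hann : ∀ r ∈ rs, r ∈ Module.annihilator R X) :
    Nonempty (linkModule K rs.length φ ≃ₗ[R]
      LinearMap.range (LinearMap.lcomp R B (LinearMap.ker φ.hom).subtype)) := by
  obtain ⟨θ, hθ⟩ := h.exists_ext
  let e (V : ModuleCat.{u} R) (hV : ∀ r ∈ rs, r ∈ Module.annihilator R V) :
      (V →ₗ[R] B) ≃ₗ[R] Ext V K rs.length :=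
    (extZeroEquiv V B).symm ≪≫ₗ LinearEquiv.ofBijective _ (hθ V hV)
  have hannU : ∀ r ∈ rs, r ∈ Module.annihilator R (kernelObj φ) := fun r hr =>
    annihilator_le_kernelObj φ (hann r hr)
  have hcomm : extMap K rs.length (kerIncl φ) ∘ₗ (e X hann).toLinearMap =
      (e (kernelObj φ) hannU).toLinearMap ∘ₗ
        LinearMap.lcomp R B (LinearMap.ker φ.hom).subtype := by
    ext f
    change (Ext.mk₀ (kerIncl φ)).comp ((Ext.mk₀ (ModuleCat.ofHom f)).comp θ (zero_add _))
      (zero_add _) = (Ext.mk₀ (ModuleCat.ofHom (f ∘ₗ (LinearMap.ker φ.hom).subtype))).comp θ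
        (zero_add _)
    rw [Ext.mk₀_comp_mk₀_assoc]
    rfl
  have hrange : LinearMap.range (extMap K rs.length (kerIncl φ)) =
      (LinearMap.range (LinearMap.lcomp R B (LinearMap.ker φ.hom).subtype)).map
        (e (kernelObj φ) hannU).toLinearMap := by
    rw [← LinearMap.range_comp, ← hcomm, LinearMap.range_comp_of_range_eq_top _
      (LinearEquiv.range _)]
  exact ⟨LinearEquiv.ofEq _ _ hrange ≪≫ₗ ((e (kernelObj φ) hannU).submoduleMap _).symm⟩

end Linkage


theorem RegQuot.exists_surjective {R : Type u} [CommRing R] {rs : List R} {A B : ModuleCat.{u} R}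
    (h : RegQuot rs A B) : ∃ f : A ⟶ B, Function.Surjective f := by
  induction h with
  | nil e => exact ⟨e.hom, e.toLinearEquiv.surjective⟩
  | cons hx p hp hk _ ih =>
    obtain ⟨f, hf⟩ := ih
    exact ⟨p ≫ f, hf.comp hp⟩

theorem RegQuot.mem_annihilator {R : Type u} [CommRing R] {rs : List R} {A B : ModuleCat.{u} R}
    (h : RegQuot rs A B) : ∀ r ∈ rs, r ∈ Module.annihilator R B := by
  induction h with
  | nil e => simp
  | @cons x rs A B C hx p hp hk h ih =>
    rintro r hr
    obtain rfl | hr := List.mem_cons.1 hr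
    · obtain ⟨f, hf⟩ := h.exists_surjective
      refine LinearMap.annihilator_le_of_surjective f.hom hf (Module.mem_annihilator.2 fun c => ?_)
      obtain ⟨a, rfl⟩ := hp c
      exact (p.hom.map_smul r a).symm.trans ((hk _).2 ⟨a, rfl⟩)
    · exact ih r hr

section LinkageBaseChange

variable {R : Type u} [CommRing R] [IsNoetherianRing R] (S : Type u) [CommRing S] [Algebra R S]
  [Module.Flat R S]

/-- `S ⊗ Hom(U, B) ≅ Hom(S ⊗ U, S ⊗ B)`. -/
def homBaseChangeEquiv (U B : ModuleCat.{u} R) [Module.Finite R U] :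
    S ⊗[R] (U →ₗ[R] B) ≃ₗ[S] (S ⊗[R] U →ₗ[S] S ⊗[R] B) :=
  have := Module.finitePresentation_of_finite R U
  (Module.FinitePresentation.isBaseChange_map R U B S).equiv

theorem homBaseChangeEquiv_tmul {U B : ModuleCat.{u} R} [Module.Finite R U] (s : S)
    (f : U →ₗ[R] B) : homBaseChangeEquiv S U B (s ⊗ₜ f) = s • f.baseChange S :=
  IsBaseChange.equiv_tmul _ s f

theorem exists_linearEquiv_baseChange_range {U X B : ModuleCat.{u} R} [Module.Finite R U]
    [Module.Finite R X] (j : U →ₗ[R] X)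
    (h : ∀ f : S ⊗[R] U →ₗ[S] S ⊗[R] B, ∃ g : S ⊗[R] X →ₗ[S] S ⊗[R] B,
      g ∘ₗ j.baseChange S = f) :
    Nonempty (S ⊗[R] LinearMap.range (LinearMap.lcomp R B j) ≃ₗ[S]
      (S ⊗[R] U →ₗ[S] S ⊗[R] B)) := by
  have hcomm (z : S ⊗[R] (X →ₗ[R] B)) :
      homBaseChangeEquiv S U B ((LinearMap.lcomp R B j).baseChange S z) =
        homBaseChangeEquiv S X B z ∘ₗ j.baseChange S := by
    induction z with
    | zero => simp
    | tmul s f =>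
      rw [LinearMap.baseChange_tmul, homBaseChangeEquiv_tmul, homBaseChangeEquiv_tmul,
        LinearMap.smul_comp, ← LinearMap.baseChange_comp]
      rfl
    | add x y hx hy => rw [map_add, map_add, map_add, hx, hy, LinearMap.add_comp]
  have hbij : Function.Bijective
      ((LinearMap.range (LinearMap.lcomp R B j)).subtype.baseChange S) := by
    refine ⟨Module.Flat.lTensor_preserves_injective_linearMap (M := S) _
      (Submodule.injective_subtype _), fun z => ?_⟩
    obtain ⟨g, hg⟩ := h (homBaseChangeEquiv S U B z)
    refine ⟨(LinearMap.lcomp R B j).rangeRestrict.baseChange S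
      ((homBaseChangeEquiv S X B).symm g), ?_⟩
    apply (homBaseChangeEquiv S U B).injective
    rw [← hg, ← LinearMap.comp_apply, ← LinearMap.baseChange_comp,
      LinearMap.subtype_comp_codRestrict, hcomm, LinearEquiv.apply_symm_apply]
  exact ⟨LinearEquiv.ofBijective _ hbij ≪≫ₗ homBaseChangeEquiv S U B⟩

theorem RegQuot.exists_linearEquiv_baseChange {K B X : ModuleCat.{u} R} {rs : List R}
    (h : RegQuot rs K B) [Module.Finite R X] (hX : ∀ r ∈ rs, r ∈ Module.annihilator R X) :
    Nonempty (S ⊗[R] Ext X K rs.length ≃ₗ[S]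
      Ext (baseChangeObj S X) (baseChangeObj S K) rs.length) := by
  obtain ⟨e⟩ := h.exists_linearEquiv hX
  obtain ⟨e'⟩ := (h.baseChange S).exists_linearEquiv (V := baseChangeObj S X) fun r hr => by
    obtain ⟨r, hr', rfl⟩ := List.mem_map.1 hr
    exact algebraMap_mem_annihilator_baseChange S (hX r hr')
  rw [List.length_map] at e'
  exact ⟨(LinearEquiv.baseChange R S _ _ e.symm) ≪≫ₗ homBaseChangeEquiv S X B ≪≫ₗ e'⟩

theorem exists_free_iso_baseChange [IsLocalRing S] [IsNoetherianRing S] {K : ModuleCat.{u} R}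
    (hK : IsSemidualizing K) {n : ℕ} {X Y : ModuleCat.{u} R} (hX : HasRes (fgProj R) n X)
    (hY : HasRes (fgProj R) n Y) (hXR : ∀ i < n, Subsingleton (Ext X (ModuleCat.of R R) i))
    (e : Y ≅ ModuleCat.of R (Ext X K n)) (hne : Nontrivial (S ⊗[R] X)) :
    ∃ q : ℕ, Nonempty (ModuleCat.of S (Fin q → S) ≅ baseChangeObj S K) := by
  have hXfin := hX.finite fun h => h.1
  have := hK.finite
  obtain ⟨rs, C, rfl, hrs, hC⟩ := (isSemidualizing_self (R := R)).exists_regQuot hXR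
  obtain ⟨ss, B, hlen, hss, hB⟩ := hK.exists_regQuot hXR
  have hann : ∀ r ∈ rs.map (algebraMap R S), r ∈ Module.annihilator S (baseChangeObj S X) := by
    intro r hr
    obtain ⟨r, hr', rfl⟩ := List.mem_map.1 hr
    exact algebraMap_mem_annihilator_baseChange S (hrs r hr')
  have hann' : ∀ r ∈ ss.map (algebraMap R S), r ∈ Module.annihilator S (baseChangeObj S X) := by
    intro r hr
    obtain ⟨r, hr', rfl⟩ := List.mem_map.1 hr
    exact algebraMap_mem_annihilator_baseChange S (hss r hr')
  have hC' : RegQuot (rs.map (algebraMap R S)) (ModuleCat.of S S) (baseChangeObj S C) :=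
    (hC.baseChange S).of_iso_left (TensorProduct.AlgebraTensorModule.rid R S S).symm.toModuleIso
  obtain ⟨e'⟩ := hB.exists_linearEquiv_baseChange S hss
  rw [hlen] at e'
  have : Module.Finite S (baseChangeObj S K) := inferInstanceAs (Module.Finite S (S ⊗[R] K))
  have : Nontrivial (baseChangeObj S X) := hne
  have hlen' : (rs.map (algebraMap R S)).length = rs.length := List.length_map ..
  have hYS := (hY.baseChange S).hasProjectiveDimensionLE
  refine free_of_hasProjectiveDimensionLE_ext (rs := rs.map (algebraMap R S))
    (K := baseChangeObj S K) (X := baseChangeObj S X) (hlen'.symm ▸ hX.baseChange S) hC' hann (fun i hi => ?_) ?_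
  · exact (hB.baseChange S).subsingleton_ext hann' i (by simpa [hlen] using hi)
  · rw [hlen']
    exact hasProjectiveDimensionLT_of_iso (baseChangeIso S e ≪≫
      LinearEquiv.toModuleIso (X₁ := S ⊗[R] Ext X K rs.length) e') (rs.length + 1)

omit [IsNoetherianRing R] in
/-- A regular sequence on `K` is lifted along `R → S ← Q`, where `S` is obtained from `Q` by
factoring out a regular sequence. -/
theorem RegQuot.exists_restrict_baseChange {Q : Type u} [CommRing Q] (π : Q →+* S)
    (hπ : Function.Surjective π) {K B : ModuleCat.{u} R} {rs : List R} (hB : RegQuot rs K B)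
    {xs : List Q} (hxs : RegQuot xs (ModuleCat.of Q Q) (restrictObj π (ModuleCat.of S S))) {q : ℕ}
    (e : ModuleCat.of S (Fin q → S) ≅ baseChangeObj S K) :
    ∃ zs : List Q, zs.length = xs.length + rs.length ∧
      RegQuot zs (ModuleCat.of Q (Fin q → Q)) (restrictObj π (baseChangeObj S B)) ∧
      ∀ V : ModuleCat.{u} R, (∀ r ∈ rs, r ∈ Module.annihilator R V) →
        ∀ z ∈ zs, z ∈ Module.annihilator Q (restrictObj π (baseChangeObj S V)) := by
  have hπs : Function.RightInverse (Function.surjInv hπ) π := Function.rightInverse_surjInv hπ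
  let ys : List Q := rs.map fun r => Function.surjInv hπ (algebraMap R S r)
  have hys : ys.map π = rs.map (algebraMap R S) := by
    rw [List.map_map]
    exact List.map_congr_left fun r _ => hπs _
  have hreg : RegQuot (xs ++ ys) (ModuleCat.of Q (Fin q → Q))
      (restrictObj π (baseChangeObj S B)) := by
    refine (((hxs.pi q).of_iso_right (restrictPiIso π _ q ≪≫ restrictIso π e))).append
      (RegQuot.restrict π ?_)
    rw [hys]
    exact hB.baseChange S
  have hx : ∀ x ∈ xs, π x = 0 := by
    intro x hx
    have := Module.mem_annihilator.1 (hxs.mem_annihilator x hx) (1 : S)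
    exact (mul_one (π x)).symm.trans this
  refine ⟨xs ++ ys, by simp [ys], hreg, fun V hV r hr => ?_⟩
  refine mem_annihilator_restrict π ?_
  obtain hr | hr := List.mem_append.1 hr
  · rw [hx r hr]
    exact zero_mem _
  · obtain ⟨r, hr', rfl⟩ := List.mem_map.1 hr
    rw [hπs]
    exact algebraMap_mem_annihilator_baseChange S (hV r hr')

theorem hasProjectiveDimensionLE_restrict_linkModule {Q : Type u} [CommRing Q] [IsNoetherianRing Q]
    (π : Q →+* S) (hπ : Function.Surjective π) {K B : ModuleCat.{u} R} {rs : List R}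
    (hB : RegQuot rs K B) {X M : ModuleCat.{u} R} [Module.Finite R X] (φ : X ⟶ M)
    (hφ : Function.Surjective φ) (hann : ∀ r ∈ rs, r ∈ Module.annihilator R X)
    {xs : List Q} (hxs : RegQuot xs (ModuleCat.of Q Q) (restrictObj π (ModuleCat.of S S))) {q : ℕ}
    (e : ModuleCat.of S (Fin q → S) ≅ baseChangeObj S K)
    (hX : HasProjectiveDimensionLE (restrictObj π (baseChangeObj S X)) (xs.length + rs.length))
    (hM : HasProjectiveDimensionLE (restrictObj π (baseChangeObj S M)) (xs.length + rs.length)) :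
    HasProjectiveDimensionLE (restrictObj π (baseChangeObj S (linkModule K rs.length φ)))
      (xs.length + rs.length) := by
  obtain ⟨zs, hlen, hreg, hannQ⟩ := hB.exists_restrict_baseChange S π hπ hxs e
  have hT := shortExact_restrict π (shortExact_baseChange S (shortExact_kernel φ hφ))
  have hannU : ∀ r ∈ rs, r ∈ Module.annihilator R (kernelObj φ) := fun r hr =>
    annihilator_le_kernelObj φ (hann r hr)
  have : Module.Finite R (kernelObj φ) := inferInstanceAs (Module.Finite R (LinearMap.ker φ.hom))
  have hM' : HasProjectiveDimensionLT (restrictObj π (baseChangeObj S M))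
      (xs.length + rs.length + 1 + 1) :=
    hasProjectiveDimensionLT_of_ge _ (xs.length + rs.length + 1) _ (by omega)
  have hExt : Subsingleton (Ext (restrictObj π (baseChangeObj S M)) (ModuleCat.of Q (Fin q → Q))
      (zs.length + 1)) :=
    HasProjectiveDimensionLT.subsingleton _ (xs.length + rs.length + 1) _ (by omega) _
  have hU : HasProjectiveDimensionLE (restrictObj π (baseChangeObj S (kernelObj φ)))
      (xs.length + rs.length) :=
    hT.hasProjectiveDimensionLT_X₁ (xs.length + rs.length + 1) hX hM'
  have hext (f : S ⊗[R] kernelObj φ →ₗ[S] S ⊗[R] B) : ∃ g : S ⊗[R] X →ₗ[S] S ⊗[R] B,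
      g ∘ₗ (LinearMap.ker φ.hom).subtype.baseChange S = f := by
    obtain ⟨g, hg⟩ := hreg.exists_extension hT (hannQ X hann) hExt
      ((ModuleCat.restrictScalars.{u} π).map (ModuleCat.ofHom (Y := S ⊗[R] B) f))
    refine ⟨(restrictHomIso π hπ (baseChangeObj S X) (baseChangeObj S B)).hom g.hom, ?_⟩
    exact LinearMap.ext fun z => congr($hg z)
  obtain ⟨e₁⟩ := linkModule_iso_range hB φ hann
  obtain ⟨e₂⟩ := exists_linearEquiv_baseChange_range S (B := B) _ hext
  obtain ⟨e₃⟩ := hreg.exists_linearEquiv (hannQ (kernelObj φ) hannU)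
  have : Module.Finite Q (restrictObj π (baseChangeObj S (kernelObj φ))) :=
    finite_restrict (hV := inferInstanceAs (Module.Finite S (S ⊗[R] kernelObj φ))) π hπ _
  have hE := (HasRes.of_hasProjectiveDimensionLE hU).hasProjectiveDimensionLE_ext
    (K := ModuleCat.of Q (Fin q → Q)) (inferInstanceAs (Module.Projective Q (Fin q → Q)))
    fun i hi => hreg.subsingleton_ext (hannQ (kernelObj φ) hannU) i (by omega)
  rw [hlen] at e₃
  exact hasProjectiveDimensionLT_of_iso (e₃.symm.toModuleIso ≪≫ restrictHomIso π hπ _ _ ≪≫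
    restrictIso π (LinearEquiv.toModuleIso e₂.symm) ≪≫
    restrictIso π (baseChangeIso S (LinearEquiv.toModuleIso e₁.symm))) _

end LinkageBaseChange


/-! ### Perfect and `C`-perfect modules along linkage -/

section PerfectLinkage

variable {R : Type u} [CommRing R]

theorem hasProjectiveDimensionLE_restrict_of_regQuot {Q S : Type u} [CommRing Q] [CommRing S]
    (π : Q →+* S) {xs : List Q}
    (hxs : RegQuot xs (ModuleCat.of Q Q) (restrictObj π (ModuleCat.of S S))) :
    HasProjectiveDimensionLE (restrictObj π (ModuleCat.of S S)) xs.length :=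
  hxs.hasProjectiveDimensionLE (p := 0)
    (hasProjectiveDimensionLT_one_iff.2 (inferInstanceAs (Module.Projective Q Q)))

theorem hasProjectiveDimensionLE_of_subsingleton {V : ModuleCat.{u} R} (hV : Subsingleton V)
    (n : ℕ) : HasProjectiveDimensionLE V n :=
  have := (ModuleCat.isZero_of_subsingleton V).hasProjectiveDimensionLT_zero
  hasProjectiveDimensionLT_of_ge _ 0 _ (by omega)

/-- If `R → S ← Q` with `S` flat over `R` and a quotient of `Q` by a regular sequence of
length `c`, and `N` is annihilated by an `R`-regular sequence of length `n`, then
`pd_Q(S ⊗ N) ≥ c + n`, unless `S ⊗ N = 0`. -/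
theorem length_le_of_hasProjectiveDimensionLE_restrict {Q S : Type u} [CommRing Q]
    [IsNoetherianRing Q] [CommRing S] [Algebra R S] [Module.Flat R S] (π : Q →+* S)
    (hπ : Function.Surjective π) {xs : List Q}
    (hxs : RegQuot xs (ModuleCat.of Q Q) (restrictObj π (ModuleCat.of S S))) {rs : List R}
    {C N : ModuleCat.{u} R} (hC : RegQuot rs (ModuleCat.of R R) C) [Module.Finite R N]
    (hrs : ∀ r ∈ rs, r ∈ Module.annihilator R N) (hN : Nontrivial (S ⊗[R] N)) {k : ℕ}
    (h : HasProjectiveDimensionLE (restrictObj π (baseChangeObj S N)) (xs.length + k)) :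
    rs.length ≤ k := by
  by_contra! hlt
  obtain ⟨zs, hlen, hreg, hann⟩ := hC.exists_restrict_baseChange S π hπ hxs (q := 1)
    (LinearEquiv.toModuleIso (LinearEquiv.funUnique (Fin 1) S S ≪≫ₗ
      (TensorProduct.AlgebraTensorModule.rid R S S).symm))
  have : Module.Finite Q (restrictObj π (baseChangeObj S N)) :=
    finite_restrict (hV := inferInstanceAs (Module.Finite S (S ⊗[R] N))) π hπ _
  refine not_subsingleton_iff_nontrivial.2 hN (subsingleton_of_hasProjectiveDimensionLT h
    fun i hi => ?_)
  have := hreg.subsingleton_ext (hann N hrs) i (by omega)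
  exact (extCongrRight _ (LinearEquiv.funUnique (Fin 1) Q Q).toModuleIso
    i).symm.injective.subsingleton

theorem regQuot_quasiDeformation [IsLocalRing R] (D : QuasiDeformation R) :
    RegQuot D.seq (ModuleCat.of D.Q D.Q) (restrictObj D.π (ModuleCat.of D.R' D.R')) := by
  let f : D.Q →ₗ[D.Q] restrictObj D.π (ModuleCat.of D.R' D.R') :=
    LinearMap.toSpanSingleton D.Q (restrictObj D.π (ModuleCat.of D.R' D.R')) (1 : D.R')
  have hf (q : D.Q) : f q = D.π q := mul_one (D.π q)
  have hsurj : Function.Surjective f := fun x => by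
    obtain ⟨q, hq⟩ := D.surjective x
    exact ⟨q, (hf q).trans hq⟩
  have hker : Ideal.ofList D.seq • (⊤ : Submodule D.Q D.Q) = LinearMap.ker f := by
    rw [smul_eq_mul, Ideal.mul_top, ← D.ker_eq]
    ext q
    rw [LinearMap.mem_ker, hf]
    rfl
  exact (RegQuot.of_isWeaklyRegular (A := ModuleCat.of D.Q D.Q)
    D.isRegular.toIsWeaklyRegular).of_iso_right
    (Submodule.quotEquivOfEq _ _ hker ≪≫ₗ f.quotKerEquivOfSurjective hsurj).toModuleIso

theorem pdRing_eq [IsLocalRing R] (D : QuasiDeformation R) : D.pdRing = D.seq.length := by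
  have hreg := regQuot_quasiDeformation D
  refine le_antisymm ((projectiveDimension_le_iff _ _).2
    (hasProjectiveDimensionLE_restrict_of_regQuot D.π hreg)) ?_
  by_contra! hlt
  have : Module.Finite D.Q (restrictObj D.π (ModuleCat.of D.R' D.R')) :=
    finite_restrict (hV := inferInstanceAs (Module.Finite D.R' D.R')) D.π D.surjective _
  refine not_subsingleton D.R' (subsingleton_of_hasProjectiveDimensionLT
    (Z := restrictObj D.π (ModuleCat.of D.R' D.R')) (projectiveDimension_lt_iff.1 hlt)
    (hreg.subsingleton_ext hreg.mem_annihilator))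

variable [IsNoetherianRing R]

theorem exists_free_iso_or_subsingleton (L : Type u) [CommRing L] [IsLocalRing L]
    [IsNoetherianRing L] [Algebra R L] [Module.Flat R L] {K : ModuleCat.{u} R}
    (hK : IsSemidualizing K) {n : ℕ} {X Y N : ModuleCat.{u} R} (hX : HasRes (fgProj R) n X)
    (hY : HasRes (fgProj R) n Y) (hXR : ∀ i < n, Subsingleton (Ext X (ModuleCat.of R R) i))
    (e : Y ≅ ModuleCat.of R (Ext X K n)) (ψ : Y ⟶ N) (hψ : Function.Surjective ψ) :
    (∃ q : ℕ, Nonempty (ModuleCat.of L (Fin q → L) ≅ baseChangeObj L K)) ∨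
      Subsingleton (L ⊗[R] N) := by
  obtain h | h := subsingleton_or_nontrivial (L ⊗[R] X)
  · right
    have := hX.finite fun h => h.1
    obtain ⟨rs, B, rfl, hrs, hB⟩ := hK.exists_regQuot hXR
    obtain ⟨e'⟩ := hB.exists_linearEquiv hrs
    have h₁ : Subsingleton (L ⊗[R] (X →ₗ[R] B)) :=
      (homBaseChangeEquiv L X B).injective.subsingleton
    have h₂ : Subsingleton (L ⊗[R] Y) :=
      (LinearEquiv.baseChange R L _ _ (e.toLinearEquiv ≪≫ₗ e'.symm)).injective.subsingleton
    exact (baseChangeMap_surjective L ψ hψ).subsingleton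
  · exact Or.inl (exists_free_iso_baseChange L hK hX hY hXR e h)

variable {K : ModuleCat.{u} R} {n : ℕ} {X M Y N : ModuleCat.{u} R}

theorem hasProjectiveDimensionLE_restrict_of_linked (hK : IsSemidualizing K) {φ : X ⟶ M}
    (hφ : Function.Surjective φ) {ψ : Y ⟶ N} (hψ : Function.Surjective ψ)
    (hX : HasRes (fgProj R) n X) (hY : HasRes (fgProj R) n Y)
    (hXR : ∀ i < n, Subsingleton (Ext X (ModuleCat.of R R) i))
    (h : EpiEquiv ψ (linkMap K n φ)) (L S : Type u) [CommRing L] [IsLocalRing L]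
    [IsNoetherianRing L] [Algebra R L] [Module.Flat R L] [CommRing S] [Algebra L S]
    [Module.Flat L S] [Algebra R S] [IsScalarTower R L S] {Q : Type u} [CommRing Q]
    [IsNoetherianRing Q] (π : Q →+* S) (hπ : Function.Surjective π) {xs : List Q}
    (hxs : RegQuot xs (ModuleCat.of Q Q) (restrictObj π (ModuleCat.of S S)))
    (hM : HasProjectiveDimensionLE (restrictObj π (baseChangeObj S M)) (xs.length + n)) :
    HasProjectiveDimensionLE (restrictObj π (baseChangeObj S N)) (xs.length + n) := by
  have : Module.Flat R S := Module.Flat.trans R L S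
  obtain ⟨α, β, -⟩ := h
  obtain ⟨q, ⟨e⟩⟩ | h₀ := exists_free_iso_or_subsingleton L hK hX hY hXR β ψ hψ
  · have := hX.finite fun h => h.1
    obtain ⟨rs, B, rfl, hrs, hB⟩ := hK.exists_regQuot hXR
    have e' : ModuleCat.of S (Fin q → S) ≅ baseChangeObj S K :=
      LinearEquiv.toModuleIso ((TensorProduct.piScalarRight L S S (Fin q)).symm ≪≫ₗ
        LinearEquiv.baseChange L S _ _ e.toLinearEquiv ≪≫ₗ
        TensorProduct.AlgebraTensorModule.cancelBaseChange R L S S K)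
    have := hasProjectiveDimensionLE_restrict_linkModule S π hπ hB φ hφ hrs hxs e'
      ((hX.baseChange S).hasProjectiveDimensionLE_restrict π
        (hasProjectiveDimensionLE_restrict_of_regQuot π hxs)) hM
    exact hasProjectiveDimensionLT_of_iso (restrictIso π (baseChangeIso S α.symm)) _
  · have : Subsingleton (S ⊗[R] N) :=
      (TensorProduct.AlgebraTensorModule.cancelBaseChange R L S S N).symm.injective.subsingleton
    exact hasProjectiveDimensionLE_of_subsingleton this _

theorem hasRes_of_perfectOfGrade (h : perfectOfGrade R n X) : HasRes (fgProj R) n X := by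
  have := h.1.1
  refine .of_hasProjectiveDimensionLE ((projectiveDimension_le_iff X n).1 ?_)
  rw [← h.1.2, h.2]
  rfl

omit [IsNoetherianRing R] in
theorem subsingleton_ext_of_grade_eq (h : grade X = n) (i : ℕ) (hi : i < n) :
    Subsingleton (Ext X (ModuleCat.of R R) i) :=
  subsingleton_ext_of_lt_grade (by rw [h]; exact_mod_cast hi)

/-- The base change to the localization at a maximal ideal. -/
def localizationIso (m : MaximalSpectrum R) (N : ModuleCat.{u} R) :
    baseChangeObj (Localization.AtPrime m.asIdeal) N ≅
      ModuleCat.of (Localization.AtPrime m.asIdeal)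
        (LocalizedModule m.asIdeal.primeCompl N) :=
  (LocalizedModule.equivTensorProduct m.asIdeal.primeCompl N).symm.toModuleIso

theorem hasProjectiveDimensionLE_iff_localization (N : ModuleCat.{u} R) [Module.Finite R N]
    (n : ℕ) : HasProjectiveDimensionLE N n ↔ ∀ m : MaximalSpectrum R,
      HasProjectiveDimensionLE (baseChangeObj (Localization.AtPrime m.asIdeal) N) n := by
  rw [ModuleCat.hasProjectiveDimensionLE_iff_forall_maximalSpectrum]
  refine forall_congr' fun m => ?_
  have e : baseChangeObj (Localization.AtPrime m.asIdeal) N ≅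
      N.localizedModule m.asIdeal.primeCompl :=
    localizationIso m N ≪≫ (Shrink.linearEquiv.{u} (Localization.AtPrime m.asIdeal)
      (LocalizedModule m.asIdeal.primeCompl N)).symm.toModuleIso
  exact ⟨fun h => hasProjectiveDimensionLT_of_iso e.symm _,
    fun h => hasProjectiveDimensionLT_of_iso e _⟩

theorem DirectlyLinked.isPerfect (hK : IsSemidualizing K)
    (h : DirectlyLinked K n (perfectOfGrade R n) M N) (hM : IsPerfect M) : IsPerfect N := by
  obtain ⟨X, Y, φ, ψ, hφ, hψ, -, hL⟩ := h
  have hNn : grade N = n := hψ.grade_eq.trans hψ.source.2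
  have hMn : grade M = n := hφ.grade_eq.trans hφ.source.2
  have hMP := hasRes_of_perfectOfGrade ⟨hM, hMn⟩
  have := hψ.finite
  refine ⟨hψ.finite, le_antisymm ?_ ?_⟩
  · rw [hNn]
    by_contra! hlt
    have := nontrivial_of_grade_eq hNn
    exact not_subsingleton N (subsingleton_of_hasProjectiveDimensionLT
      (projectiveDimension_lt_iff.1 hlt) (subsingleton_ext_of_grade_eq hNn))
  · rw [hNn]
    refine (projectiveDimension_le_iff N n).2 ((hasProjectiveDimensionLE_iff_localization N n).2
      fun m => ?_)
    let L := Localization.AtPrime m.asIdeal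
    let e (V : ModuleCat.{u} L) : restrictObj (RingHom.id L) V ≅ V :=
      ModuleCat.restrictScalarsId'App _ rfl V
    have hML := (hMP.baseChange L).hasProjectiveDimensionLE
    have hNL := hasProjectiveDimensionLE_restrict_of_linked hK hφ.surjective hψ.surjective
      (hasRes_of_perfectOfGrade hφ.source) (hasRes_of_perfectOfGrade hψ.source)
      (subsingleton_ext_of_grade_eq hφ.source.2) hL L L (RingHom.id L) Function.surjective_id
      (xs := []) (.nil (e _).symm)
      (by simpa using hasProjectiveDimensionLT_of_iso (e (baseChangeObj L M)).symm (n + 1))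
    rw [List.length_nil, zero_add] at hNL
    exact hasProjectiveDimensionLT_of_iso (e (baseChangeObj L N)) (n + 1)

omit [IsNoetherianRing R] in
theorem pdModule_le_iff [IsLocalRing R] (D : QuasiDeformation R) (V : ModuleCat.{u} R) (k : ℕ) :
    D.pdModule V ≤ D.pdRing + ((k : ℕ∞) : WithBot ℕ∞) ↔
      HasProjectiveDimensionLE (restrictObj D.π (baseChangeObj D.R' V)) (D.seq.length + k) := by
  rw [pdRing_eq, ← projectiveDimension_le_iff]
  push_cast
  rfl

omit [IsNoetherianRing R] in
theorem ciDimLocal_le_iff [IsLocalRing R] (V : ModuleCat.{u} R) (k : ℕ) :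
    ciDimLocal V ≤ k ↔ ∃ D : QuasiDeformation R,
      HasProjectiveDimensionLE (restrictObj D.π (baseChangeObj D.R' V)) (D.seq.length + k) := by
  simp_rw [← pdModule_le_iff]
  refine ⟨fun h => ?_, fun h => sInf_le h⟩
  have hne : {k : ℕ∞ | ∃ D : QuasiDeformation R,
      D.pdModule V ≤ D.pdRing + (k : WithBot ℕ∞)}.Nonempty := by
    by_contra hempty
    rw [Set.not_nonempty_iff_eq_empty] at hempty
    rw [ciDimLocal, hempty, sInf_empty] at h
    exact absurd h (by simp)
  obtain ⟨D, hD⟩ := csInf_mem hne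
  exact ⟨D, hD.trans (add_le_add le_rfl (WithBot.coe_le_coe.2 h))⟩

omit [IsNoetherianRing R] in
theorem le_ciDimLocal [IsLocalRing R] (V : ModuleCat.{u} R) {n : ℕ}
    (h : ∀ (D : QuasiDeformation R) (k : ℕ), HasProjectiveDimensionLE
      (restrictObj D.π (baseChangeObj D.R' V)) (D.seq.length + k) → n ≤ k) :
    (n : ℕ∞) ≤ ciDimLocal V := by
  refine le_sInf ?_
  rintro k ⟨D, hD⟩
  induction k using ENat.recTopCoe with
  | top => exact le_top
  | coe k => exact_mod_cast h D k ((pdModule_le_iff D V k).1 hD)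

section QuasiDeformation

omit [IsNoetherianRing R]

variable (m : MaximalSpectrum R) (D : QuasiDeformation (Localization.AtPrime m.asIdeal))

/-- The ring `R'` of a quasi-deformation of a localization of `R`, as an `R`-algebra. -/
abbrev algebraQuasiDeformation : Algebra R D.R' :=
  ((algebraMap (Localization.AtPrime m.asIdeal) D.R').comp
    (algebraMap R (Localization.AtPrime m.asIdeal))).toAlgebra

theorem isScalarTower_quasiDeformation :
    letI := algebraQuasiDeformation m D
    IsScalarTower R (Localization.AtPrime m.asIdeal) D.R' :=
  letI := algebraQuasiDeformation m D
  IsScalarTower.of_algebraMap_eq fun _ => rfl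

/-- Base change in two steps. -/
def quasiDeformationIso (N : ModuleCat.{u} R) :
    letI := algebraQuasiDeformation m D
    baseChangeObj D.R' (ModuleCat.of (Localization.AtPrime m.asIdeal)
      (LocalizedModule m.asIdeal.primeCompl N)) ≅ baseChangeObj D.R' N :=
  let := algebraQuasiDeformation m D
  haveI := isScalarTower_quasiDeformation m D
  baseChangeIso D.R' (localizationIso m N).symm ≪≫
    (TensorProduct.AlgebraTensorModule.cancelBaseChange R (Localization.AtPrime m.asIdeal)
      D.R' D.R' N).toModuleIso

end QuasiDeformation

theorem le_ciDim (N : ModuleCat.{u} R) [Module.Finite R N] [Nontrivial N]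
    (hN : ∀ i < n, Subsingleton (Ext N (ModuleCat.of R R) i)) : (n : ℕ∞) ≤ ciDim N := by
  obtain ⟨m, hm⟩ : ∃ m : MaximalSpectrum R,
      Nontrivial (LocalizedModule m.asIdeal.primeCompl N) := by
    by_contra! h
    refine not_subsingleton N (Module.subsingleton_of_localization_maximal (R := R)
      (fun p _ => LocalizedModule p.primeCompl N)
      (fun p _ => LocalizedModule.mkLinearMap p.primeCompl N) fun p hp => ?_)
    exact h ⟨p, hp⟩
  refine le_iSup_of_le m (le_ciDimLocal _ fun D k h => ?_)
  let := algebraQuasiDeformation m D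
  have := isScalarTower_quasiDeformation m D
  have : Module.Flat R D.R' := Module.Flat.trans R (Localization.AtPrime m.asIdeal) D.R'
  have : Module.FaithfullyFlat (Localization.AtPrime m.asIdeal) D.R' :=
    Module.FaithfullyFlat.of_flat_of_isLocalHom
  obtain ⟨rs, C, rfl, hrs, hC⟩ := (isSemidualizing_self (R := R)).exists_regQuot hN
  have hne : Nontrivial (D.R' ⊗[Localization.AtPrime m.asIdeal]
    LocalizedModule m.asIdeal.primeCompl N) := inferInstance
  have e := quasiDeformationIso m D N
  refine length_le_of_hasProjectiveDimensionLE_restrict D.π D.surjective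
    (regQuot_quasiDeformation D) hC hrs (e.symm.toLinearEquiv.toEquiv.nontrivial) ?_
  exact hasProjectiveDimensionLT_of_iso (restrictIso D.π e) _

theorem DirectlyLinked.isCPerfect (hK : IsSemidualizing K)
    (h : DirectlyLinked K n (perfectOfGrade R n) M N) (hM : IsCPerfect M) : IsCPerfect N := by
  obtain ⟨X, Y, φ, ψ, hφ, hψ, -, hL⟩ := h
  have hNn : grade N = n := hψ.grade_eq.trans hψ.source.2
  have hMn : grade M = n := hφ.grade_eq.trans hφ.source.2
  have := hψ.finite
  have := nontrivial_of_grade_eq hNn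
  refine ⟨hψ.finite, hNn.trans (le_antisymm (le_ciDim N (subsingleton_ext_of_grade_eq hNn))
    (iSup_le fun m => ?_))⟩
  have hMm : ciDimLocal _ ≤ (n : ℕ∞) := (le_iSup _ m).trans (hM.2.symm.trans hMn).le
  obtain ⟨D, hD⟩ := (ciDimLocal_le_iff _ n).1 hMm
  refine (ciDimLocal_le_iff _ n).2 ⟨D, ?_⟩
  let := algebraQuasiDeformation m D
  have := isScalarTower_quasiDeformation m D
  have := hasProjectiveDimensionLE_restrict_of_linked hK hφ.surjective hψ.surjective
    (hasRes_of_perfectOfGrade hφ.source) (hasRes_of_perfectOfGrade hψ.source)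
    (subsingleton_ext_of_grade_eq hφ.source.2) hL (Localization.AtPrime m.asIdeal) D.R' D.π
    D.surjective (regQuot_quasiDeformation D)
    (hasProjectiveDimensionLT_of_iso (restrictIso D.π (quasiDeformationIso m D M)) _)
  exact hasProjectiveDimensionLT_of_iso (restrictIso D.π (quasiDeformationIso m D N).symm) _

end PerfectLinkage

end

end Liaison

theorem mainTheorem6 {R : Type u} [CommRing R] [IsNoetherianRing R] (K : ModuleCat.{u} R)
    (hK : Liaison.IsSemidualizing K) (n : ℕ) (M N : ModuleCat.{u} R) :
    (Liaison.SameLiaisonClass K n (Liaison.gkPerfectOfGrade K n) M N →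
      (Liaison.IsGKPerfect K M ↔ Liaison.IsGKPerfect K N)) ∧
    (Liaison.SameLiaisonClass K n (Liaison.perfectOfGrade R n) M N →
      (Liaison.IsPerfect M ↔ Liaison.IsPerfect N) ∧
      (Liaison.IsCPerfect M ↔ Liaison.IsCPerfect N)) := by
  exact ⟨fun h => h.iff_of_directlyLinked fun h => h.isGKPerfect hK,
    fun h => ⟨h.iff_of_directlyLinked fun h => h.isPerfect hK,
      h.iff_of_directlyLinked fun h => h.isCPerfect hK⟩⟩
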